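/- Let $N\ge 1$ and let $\Omega_N$ be the unit sphere of $\mathbb C^N$ with its uniform (normalized surface) probability measure. The numerical shadow $P_A$ of $A\in M_N(\mathbb C)$ is the Borel probability measure on $\mathbb C$ that is the law of $(Au,u)=u^*Au$ for $u$ uniform on $\Omega_N$; it is called rotation-invariant if $P_{e^{i\theta}A}=P_A$ for all real $\theta$. For integers $1\le k\le N/2$ put $$R_{N,k}(y)=\frac{\Gamma(\frac N2)\Gamma(\frac{N+1}2)}{\Gamma(N-\frac12-k)\,(k-1)!}(1-y)^{N-\frac32-k}\,{}_2F_1\Bigl(\frac{N+1}2-k,\frac N2-k;N-\frac12-k;1-y\Bigr)\quad(0<y<1),$$ and $R_{N,k}(y)=0$ for $y\ge 1$. **Proposition 8.9.** Let $0\ne A\in M_N(\mathbb C)$ have rotation-invariant shadow, and let the distinct positive eigenvalues of $\operatorname{Re}A=(A+A^*)/2$ be $\mu_1,\dots,\mu_n$, where $\mu_i$ has multiplicity $k_i$. There are unique real constants $\alpha_{ij}$ $(1\le i\le n,\ 0\le j<k_i)$ with $$\frac1{\prod_{i=1}^n(1-4t^2\mu_i^2)^{k_i}}=\sum_{i=1}^n\sum_{j=0}^{k_i-1}\frac{\alpha_{ij}}{(1-4t^2\mu_i^2)^{k_i-j}}$$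 for all real $t$ at which no denominator vanishes. With these constants, $P_A$ has the density $z\mapsto f(|z|)$ with respect to planar Lebesgue measure on $\mathbb C$, where $$f(r)=\frac1\pi\sum_{i=1}^n\sum_{j=0}^{k_i-1}\alpha_{ij}\,\frac1{\mu_i^2}\,R_{N,k_i-j}\Bigl(\frac{r^2}{\mu_i^2}\Bigr).$$ -/

import Mathlib

namespace NumericalShadow

/-- Complex Euclidean space `ℂ^N`. -/
abbrev Vec (N : ℕ) : Type := EuclideanSpace ℂ (Fin N)

/-- The uniform probability measure on the unit sphere of `ℂ^N = ℝ^(2N)`: surface measure,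
normalized to total mass one (for `N ≥ 1`). -/
noncomputable def uniformSphere (N : ℕ) :
    MeasureTheory.Measure (Metric.sphere (0 : Vec N) 1) :=
  ((MeasureTheory.volume : MeasureTheory.Measure (Vec N)).toSphere Set.univ)⁻¹ •
    (MeasureTheory.volume : MeasureTheory.Measure (Vec N)).toSphere

/-- The numerical shadow of `A`: the law of `(Au, u) = u^* A u` for `u` uniformly distributed on the
unit sphere. Mathlib's inner product is conjugate-linear in its first argument. -/
noncomputable def shadow {N : ℕ} (A : Matrix (Fin N) (Fin N) ℂ) : MeasureTheory.Measure ℂ :=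
  (uniformSphere N).map
    (fun u : Metric.sphere (0 : Vec N) 1 => inner ℂ (u : Vec N) (Matrix.toEuclideanLin A (u : Vec N)))

/-- `A` and `exp(iθ) A` have the same shadow for all real `θ`. -/
def HasRotationInvariantShadow {N : ℕ} (A : Matrix (Fin N) (Fin N) ℂ) : Prop :=
  ∀ θ : ℝ, shadow (Complex.exp (θ * Complex.I) • A) = shadow A

/-- The Hermitian part `Re A = (A + A^*) / 2`. -/
noncomputable def rePart {N : ℕ} (A : Matrix (Fin N) (Fin N) ℂ) : Matrix (Fin N) (Fin N) ℂ :=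
  (1 / 2 : ℂ) • (A + A.conjTranspose)

/-- `g` is a probability density of `P` with respect to planar Lebesgue measure on `ℂ`. -/
def IsPlanarDensity (P : MeasureTheory.Measure ℂ) (g : ℂ → ℝ) : Prop :=
  MeasureTheory.Integrable g MeasureTheory.volume ∧
  (∀ᵐ z : ℂ, 0 ≤ g z) ∧
  P = MeasureTheory.volume.withDensity (fun z => ENNReal.ofReal (g z))

/-- The `α i j` are the coefficients in the partial fraction decomposition
`1 / ∏ i, (1 - 4 t² μ_i²)^(k_i) = ∑ i, ∑ j < k_i, α_ij / (1 - 4 t² μ_i²)^(k_i - j)`. -/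
def IsPartialFractionCoeffs {n : ℕ} (μ : Fin n → ℝ) (k : Fin n → ℕ)
    (α : (i : Fin n) → Fin (k i) → ℝ) : Prop :=
  ∀ t : ℝ, (∀ i, 1 - 4 * t ^ 2 * μ i ^ 2 ≠ 0) →
    1 / ∏ i, (1 - 4 * t ^ 2 * μ i ^ 2) ^ k i =
      ∑ i, ∑ j : Fin (k i), α i j / (1 - 4 * t ^ 2 * μ i ^ 2) ^ (k i - (j : ℕ))

/-- The function `R_{N,k}` (used for `1 ≤ k ≤ N / 2`), with `ordinaryHypergeometric a b c x` the
Gauss series `∑ (a)_j (b)_j / ((c)_j j!) x^j`; it vanishes for `y ≥ 1`. -/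
noncomputable def R (N k : ℕ) (y : ℝ) : ℝ :=
  if y < 1 then
    Real.Gamma ((N : ℝ) / 2) * Real.Gamma (((N : ℝ) + 1) / 2) /
        (Real.Gamma ((N : ℝ) - 1 / 2 - k) * ((k - 1).factorial : ℝ)) *
      (1 - y) ^ ((N : ℝ) - 3 / 2 - k) *
      ordinaryHypergeometric (((N : ℝ) + 1) / 2 - k) ((N : ℝ) / 2 - k) ((N : ℝ) - 1 / 2 - k) (1 - y)
  else 0

end NumericalShadow

namespace NumericalShadow

open Polynomial

/-! ### Partial fractions -/

/-! A compactly supported rotation-invariant measure on `ℂ` is determined by the even moments of `Re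
z`, so it suffices to match these moments for the shadow and for the proposed density.

For the shadow, `Re (u^* A u)` is the quadratic form of `Re A`. A Gaussian integral in eigenvector
coordinates gives its `m`-th moment as `m! Γ(N)/Γ(N+m)` times the complete homogeneous symmetric
polynomial `h_m` of the eigenvalues (`integral_re_pow_shadow`). Rotation invariance kills the odd
`h_m`, so the spectrum is symmetric and `∑ h_m s^m = ∏ (1 - μ_i² s²)^(-k_i)`. The partial fractions
then write `h_(2l)` as a combination of the coefficients of the single powers `(1 - μ_i² s²)^(-(k_i
- j))`.

For the density, Gauss's summation theorem evaluates the Mellin moments of `R`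
(`integral_pow_mul_R`). With the angular integral of `cos^(2l)` and the duplication formula, the
`(N, k)` term yields exactly the coefficient of `(1 - μ² s²)^(-k)`, with the same prefactor
(`integral_re_pow_mul_R`).

The sign of the density is not known beforehand. It follows from comparing positive measures in
`isPlanarDensity_of_moments`. -/

lemma one_div_prod_eq_sum_div_iff {n : ℕ} (k : Fin n → ℕ) (α : (i : Fin n) → Fin (k i) → ℝ)
    {D : Fin n → ℝ} (hD : ∀ i, D i ≠ 0) :
    (1 / ∏ i, D i ^ k i = ∑ i, ∑ j : Fin (k i), α i j / D i ^ (k i - (j : ℕ))) ↔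
      1 = ∑ i, ∑ j : Fin (k i), α i j * D i ^ (j : ℕ) *
        ∏ l ∈ Finset.univ.erase i, D l ^ k l := by
  rw [div_eq_iff (Finset.prod_ne_zero_iff.2 fun i _ => pow_ne_zero _ (hD i)), Finset.sum_mul]
  refine Eq.congr rfl (Finset.sum_congr rfl fun i _ => ?_)
  rw [Finset.sum_mul]
  refine Finset.sum_congr rfl fun j _ => ?_
  rw [← Finset.mul_prod_erase _ _ (Finset.mem_univ i), ← mul_assoc]
  congr 1
  rw [div_mul_eq_mul_div, div_eq_iff (pow_ne_zero _ (hD i)), mul_assoc, ← pow_add]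
  congr 2
  have := j.2
  omega

/-- The identity obtained from the partial fraction decomposition by clearing denominators, as an
identity of polynomials in `4 t²`. -/
lemma isPartialFractionCoeffs_iff {n : ℕ} (μ : Fin n → ℝ) (k : Fin n → ℕ)
    (α : (i : Fin n) → Fin (k i) → ℝ) :
    IsPartialFractionCoeffs μ k α ↔
      (1 : ℝ[X]) = ∑ i, ∑ j : Fin (k i), C (α i j) * (1 - C (μ i ^ 2) * X) ^ (j : ℕ) *
        ∏ l ∈ Finset.univ.erase i, (1 - C (μ l ^ 2) * X) ^ k l := by
  constructor
  · intro h
    refine eq_of_infinite_eval_eq _ _ ?_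
    have hfin : (⋃ i, {x : ℝ | 1 - μ i ^ 2 * x = 0}).Finite := by
      refine Set.finite_iUnion fun i => Set.Subsingleton.finite fun x hx y hy => ?_
      simp only [Set.mem_ofPred_eq] at hx hy
      have h0 : μ i ^ 2 ≠ 0 := fun h0 => by simp [h0] at hx
      exact mul_left_cancel₀ h0 (by linarith)
    -- Every `x ≥ 0` is `4 t²` with `t = √x / 2`, so the identity is known on an infinite set, which
    -- suffices for polynomials.
    refine ((Set.Ici_infinite (0 : ℝ)).sdiff hfin).mono fun x hx => ?_
    simp only [Set.mem_sdiff, Set.mem_Ici, Set.mem_iUnion, Set.mem_ofPred_eq, not_exists] at hx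
    have hD : ∀ i, 1 - 4 * (Real.sqrt x / 2) ^ 2 * μ i ^ 2 = 1 - μ i ^ 2 * x := fun i => by
      rw [div_pow, Real.sq_sqrt hx.1]
      ring
    have := h (Real.sqrt x / 2) fun i => by
      rw [hD]
      exact hx.2 i
    simp only [hD] at this
    rw [one_div_prod_eq_sum_div_iff k α hx.2] at this
    simpa [eval_finsetSum, eval_prod] using this
  · intro h t ht
    rw [one_div_prod_eq_sum_div_iff k α ht]
    have := congrArg (eval (4 * t ^ 2)) h
    simpa [eval_finsetSum, eval_prod, mul_comm] using this

lemma one_sub_C_mul_X_eq {ν : ℝ} (h : ν ≠ 0) : (1 - C ν * X : ℝ[X]) = C (-ν) * (X - C ν⁻¹) := by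
  rw [mul_sub, ← C_mul, neg_mul, mul_inv_cancel₀ h]
  simp
  ring

/-- After clearing denominators this is the expansion of `1` along powers of the pairwise coprime
linear polynomials `X - μ_i⁻²`, whose remainders are constants. If all `k i` were zero it would read
`1 = 0`, hence `hk`. -/
theorem existsUnique_isPartialFractionCoeffs {n : ℕ} {μ : Fin n → ℝ} (hinj : Function.Injective μ)
    (hpos : ∀ i, 0 < μ i) {k : Fin n → ℕ} (hk : ∃ i, 0 < k i) :
    ∃! α : (i : Fin n) → Fin (k i) → ℝ, IsPartialFractionCoeffs μ k α := by
  set g : Fin n → ℝ[X] := fun i => X - C (μ i ^ 2)⁻¹ with hg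
  have hν : ∀ i, μ i ^ 2 ≠ 0 := fun i => (pow_pos (hpos i) 2).ne'
  have hgm : ∀ i ∈ (Finset.univ : Finset (Fin n)), (g i).Monic := fun i _ => monic_X_sub_C _
  have hgc : Set.Pairwise (Finset.univ : Finset (Fin n)) fun i j => IsCoprime (g i) (g j) := by
    intro i _ j _ hij
    refine pairwise_coprime_X_sub_C (s := fun i => (μ i ^ 2)⁻¹) (fun a b hab => ?_) hij
    have := inv_injective hab
    exact hinj ((sq_eq_sq₀ (hpos a).le (hpos b).le).1 this)
  -- `w` collects the leading coefficients lost on replacing `1 - μ_i² X` by the monic `X - μ_i⁻²`;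
  -- it is nonzero, so it rescales the unknowns bijectively.
  set w : (i : Fin n) → ℕ → ℝ := fun i j =>
    (-μ i ^ 2) ^ j * ∏ l ∈ Finset.univ.erase i, (-μ l ^ 2) ^ k l with hw
  have hw0 : ∀ i j, w i j ≠ 0 := fun i j =>
    mul_ne_zero (pow_ne_zero _ (neg_ne_zero.2 (hν i)))
      (Finset.prod_ne_zero_iff.2 fun l _ => pow_ne_zero _ (neg_ne_zero.2 (hν l)))
  have hterm : ∀ (a : ℝ) i (j : ℕ), C a * (1 - C (μ i ^ 2) * X) ^ j *
      ∏ l ∈ Finset.univ.erase i, (1 - C (μ l ^ 2) * X) ^ k l =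
      C (a * w i j) * g i ^ j * ∏ l ∈ Finset.univ.erase i, g l ^ k l := fun a i j => by
    have e : ∀ i, (1 - C (μ i ^ 2) * X : ℝ[X]) = C (-μ i ^ 2) * g i := fun i =>
      one_sub_C_mul_X_eq (hν i)
    simp only [e, mul_pow, Finset.prod_mul_distrib]
    simp only [hw, map_mul, map_prod, map_pow C]
    ring
  have hdegC : ∀ i (a : ℝ), (C a).degree < (g i).degree := fun i a => by
    rw [hg, degree_X_sub_C]
    exact degree_C_le.trans_lt (by norm_num)
  obtain ⟨q, r, hr, h1⟩ := eq_quo_mul_prod_pow_add_sum_rem_mul_prod_pow (1 : ℝ[X]) hgm hgc k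
  have hrC : ∀ i j, r i j = C ((r i j).coeff 0) := fun i j => by
    have := hr i (Finset.mem_univ i) j
    rw [hg, degree_X_sub_C] at this
    exact eq_C_of_degree_le_zero (Nat.WithBot.lt_one_iff_le_zero.1 this)
  set P : ℝ[X] := ∏ i, g i ^ k i with hP
  have hPm : P.Monic := monic_prod_of_monic _ _ fun i hi => (hgm i hi).pow _
  -- Both `1` (by `hk`) and the remainder sum have degree below that of `P`, so no nonzero multiple
  -- of `P` can occur.
  have hq : q = 0 := by
    by_contra hq
    have hd : (∑ i, ∑ j, r i j * g i ^ j.1 * ∏ l ∈ Finset.univ.erase i, g l ^ k l).degree <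
        P.degree := by
      refine (degree_sum_le _ _).trans_lt ((Finset.sup_lt_iff ?_).2 fun i _ =>
        (degree_sum_le _ _).trans_lt ((Finset.sup_lt_iff ?_).2 fun j _ => ?_))
      · exact bot_lt_iff_ne_bot.2 (degree_ne_bot.2 hPm.ne_zero)
      · exact bot_lt_iff_ne_bot.2 (degree_ne_bot.2 hPm.ne_zero)
      · rw [hP, ← Finset.mul_prod_erase _ _ (Finset.mem_univ i)]
        have hm2 : (∏ l ∈ Finset.univ.erase i, g l ^ k l).Monic :=
          monic_prod_of_monic _ _ fun i _ => (hgm i (Finset.mem_univ i)).pow _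
        rw [hm2.degree_mul, hm2.degree_mul]
        refine WithBot.add_lt_add_right (degree_ne_bot.2 hm2.ne_zero) ?_
        rw [hrC]
        refine (degree_mul_le _ _).trans_lt ?_
        rw [degree_pow, degree_pow, hg, degree_X_sub_C]
        refine (add_le_add_left degree_C_le _).trans_lt ?_
        simp only [nsmul_eq_mul, mul_one, zero_add]
        exact_mod_cast j.2
    have h1d : (1 : ℝ[X]).degree < P.degree := by
      obtain ⟨i, hi⟩ := hk
      rw [degree_one, hP, degree_prod]
      refine lt_of_lt_of_le ?_ (Finset.single_le_sum (f := fun i => (g i ^ k i).degree)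
        (fun i _ => ?_) (Finset.mem_univ i))
      · rw [degree_pow, hg, degree_X_sub_C]
        simp only [nsmul_eq_mul, mul_one]
        exact_mod_cast hi
      · rw [degree_pow, hg, degree_X_sub_C]
        simp
    have h2 : q * P = 1 - ∑ i, ∑ j, r i j * g i ^ j.1 * ∏ l ∈ Finset.univ.erase i, g l ^ k l :=
      eq_sub_of_add_eq h1.symm
    have h3 : (q * P).degree < P.degree := by
      rw [h2]
      exact (degree_sub_le _ _).trans_lt (max_lt h1d hd)
    exact hPm.not_dvd_of_degree_lt (mul_ne_zero hq hPm.ne_zero) h3 (dvd_mul_left _ _)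
  refine ⟨fun i j => (r i j).coeff 0 / w i j, ?_, fun β hβ => ?_⟩
  · simp only [isPartialFractionCoeffs_iff, hterm, div_mul_cancel₀ _ (hw0 _ _), ← hrC]
    simpa [hq] using h1
  · simp only [isPartialFractionCoeffs_iff] at hβ
    simp only [hterm] at hβ
    obtain ⟨-, h2⟩ := quo_mul_prod_pow_add_sum_rem_mul_prod_pow_unique hgm hgc (n := k) (q₁ := 0)
      (q₂ := q) (r₁ := fun i j => C (β i j * w i j)) (r₂ := r) (fun i _ j => hdegC i _) hr
      (by rw [← h1, zero_mul, zero_add, ← hβ])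
    ext i j
    rw [eq_div_iff (hw0 _ _), ← congrFun (h2 i (Finset.mem_univ i)) j, coeff_C_zero]

/-! ### Complete homogeneous symmetric polynomials as coefficients of a power series -/

/-- The generating series `∏ 1 / (1 - s λ_j)` of the complete homogeneous symmetric polynomials
in the `λ_j`. -/
noncomputable def genSeries {ι : Type*} [Fintype ι] (lam : ι → ℝ) : PowerSeries ℝ :=
  ∏ j, PowerSeries.mk fun m => lam j ^ m

lemma mk_pow_mul_one_sub (a : ℝ) :
    PowerSeries.mk (fun m => a ^ m) * ((1 - C a * X : ℝ[X]) : PowerSeries ℝ) = 1 := by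
  have := congrArg (PowerSeries.rescale a) (PowerSeries.mk_one_mul_one_sub_eq_one ℝ)
  rw [map_mul, map_sub, map_one, PowerSeries.rescale_X, PowerSeries.rescale_mk] at this
  simpa using this

lemma genSeries_mul_prod {ι : Type*} [Fintype ι] (lam : ι → ℝ) :
    genSeries lam * ((∏ j, (1 - C (lam j) * X) : ℝ[X]) : PowerSeries ℝ) = 1 := by
  rw [genSeries, ← Polynomial.coeToPowerSeries.ringHom_apply, map_prod, ← Finset.prod_mul_distrib]
  exact Finset.prod_eq_one fun j _ => mk_pow_mul_one_sub _

lemma coeff_mk_pow_pow (ν : ℝ) {l : ℕ} (hl : 1 ≤ l) (m : ℕ) :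
    PowerSeries.coeff m (PowerSeries.mk (fun m => ν ^ m) ^ l) =
      ν ^ m * ((l - 1 + m).choose (l - 1) : ℝ) := by
  have h : PowerSeries.mk (fun m => ν ^ m) = PowerSeries.rescale ν (PowerSeries.mk 1) := by
    rw [PowerSeries.rescale_mk]
    simp
  obtain ⟨l, rfl⟩ := Nat.exists_eq_add_of_le' hl
  rw [h, ← map_pow, PowerSeries.mk_one_pow_eq_mk_choose_add, PowerSeries.coeff_rescale,
    PowerSeries.coeff_mk, Nat.add_sub_cancel]

theorem coeff_genSeries_of_isPartialFractionCoeffs {N n : ℕ} {lam : Fin N → ℝ} {μ : Fin n → ℝ}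
    {k : Fin n → ℕ} {α : (i : Fin n) → Fin (k i) → ℝ} (hα : IsPartialFractionCoeffs μ k α)
    (hprod : (∏ j, (1 - C (lam j) * X) : ℝ[X]) = ∏ i, (1 - C (μ i ^ 2) * X ^ 2) ^ k i) (m : ℕ) :
    PowerSeries.coeff (2 * m) (genSeries lam) = ∑ i, ∑ j : Fin (k i), α i j *
      (μ i ^ (2 * m) * ((k i - (j : ℕ) - 1 + m).choose (k i - (j : ℕ) - 1) : ℝ)) := by
  set u : Fin n → PowerSeries ℝ := fun i => ((1 - C (μ i ^ 2) * X : ℝ[X]) : PowerSeries ℝ) with hu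
  set v : Fin n → PowerSeries ℝ := fun i => PowerSeries.mk fun m => (μ i ^ 2) ^ m with hv
  have hvu : ∀ i, v i * u i = 1 := fun i => mk_pow_mul_one_sub _
  rw [isPartialFractionCoeffs_iff] at hα
  have h1 : (∏ i, v i ^ k i) = ∑ i, ∑ j : Fin (k i),
      PowerSeries.C (α i j) * v i ^ (k i - (j : ℕ)) := by
    have h2 := congrArg (fun p : ℝ[X] => (∏ i, v i ^ k i) * (p : PowerSeries ℝ)) hα
    simp only [Polynomial.coe_one, mul_one] at h2
    rw [h2, ← Polynomial.coeToPowerSeries.ringHom_apply, map_sum, Finset.mul_sum]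
    refine Finset.sum_congr rfl fun i _ => ?_
    rw [map_sum, Finset.mul_sum]
    refine Finset.sum_congr rfl fun j _ => ?_
    rw [map_mul, map_mul, map_prod, ← Finset.mul_prod_erase _ _ (Finset.mem_univ i)]
    simp only [map_pow (Polynomial.coeToPowerSeries.ringHom (R := ℝ)),
      Polynomial.coeToPowerSeries.ringHom_apply, Polynomial.coe_C]
    have h3 : (∏ l ∈ Finset.univ.erase i, v l ^ k l) * ∏ l ∈ Finset.univ.erase i, u l ^ k l = 1 := by
      rw [← Finset.prod_mul_distrib]
      exact Finset.prod_eq_one fun l _ => by rw [← mul_pow, hvu, one_pow]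
    have h4 : v i ^ k i = v i ^ (k i - (j : ℕ)) * v i ^ (j : ℕ) := by
      rw [← pow_add, Nat.sub_add_cancel j.2.le]
    have h5 : v i ^ (j : ℕ) * u i ^ (j : ℕ) = 1 := by rw [← mul_pow, hvu, one_pow]
    rw [h4]
    change _ * (_ * u i ^ (j : ℕ) * ∏ l ∈ Finset.univ.erase i, u l ^ k l) = _
    linear_combination (PowerSeries.C (α i j) * v i ^ (k i - (j : ℕ))) *
      (v i ^ (j : ℕ) * u i ^ (j : ℕ) * h3 + h5)
  -- Both sides invert the same polynomial; `expand 2` is the substitution of `X²` for `X`.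
  have h6 : genSeries lam = PowerSeries.expand 2 two_ne_zero (∏ i, v i ^ k i) := by
    have h7 := genSeries_mul_prod lam
    rw [hprod] at h7
    have h8 : PowerSeries.expand 2 two_ne_zero (∏ i, v i ^ k i) *
        ((∏ i, (1 - C (μ i ^ 2) * X ^ 2) ^ k i : ℝ[X]) : PowerSeries ℝ) = 1 := by
      have h9 : ((∏ i, (1 - C (μ i ^ 2) * X ^ 2) ^ k i : ℝ[X]) : PowerSeries ℝ) =
          PowerSeries.expand 2 two_ne_zero (∏ i, u i ^ k i) := by
        rw [← Polynomial.coeToPowerSeries.ringHom_apply, map_prod, map_prod]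
        refine Finset.prod_congr rfl fun i _ => ?_
        rw [map_pow, map_pow (PowerSeries.expand 2 two_ne_zero), hu,
          Polynomial.coeToPowerSeries.ringHom_apply]
        simp only [Polynomial.coe_sub, Polynomial.coe_one, Polynomial.coe_mul, Polynomial.coe_C,
          Polynomial.coe_pow, Polynomial.coe_X, map_sub, map_one, map_mul, PowerSeries.expand_C,
          PowerSeries.expand_X]
      rw [h9, ← map_mul, ← Finset.prod_mul_distrib]
      simp [← mul_pow, hvu]
    exact left_inv_eq_right_inv h7 (by rw [mul_comm]; exact h8)
  rw [h6, PowerSeries.coeff_expand_mul, h1, map_sum]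
  refine Finset.sum_congr rfl fun i _ => ?_
  rw [map_sum]
  refine Finset.sum_congr rfl fun j _ => ?_
  rw [PowerSeries.coeff_C_mul, coeff_mk_pow_pow _ (by have := j.2; omega), pow_mul]

end NumericalShadow

namespace NumericalShadow

open MeasureTheory Set

lemma HasSum.congr_real {f g : ℕ → ℝ} {v w : ℝ} (h : HasSum f v) (hf : ∀ n, g n = f n)
    (hvw : w = v) : HasSum g w := by
  rw [hvw, funext hf]
  exact h

/-! ### Termwise integration of series of nonnegative functions -/

/-- Dominated convergence for series, in which the nonnegative terms serve as their own bounds. -/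
lemma hasSum_integral_of_integrable_of_nonneg {X : Type*} [MeasurableSpace X] {ν : Measure X}
    {F : ℕ → X → ℝ} {g : X → ℝ} (hF : ∀ n, AEStronglyMeasurable (F n) ν)
    (h0 : ∀ n, ∀ᵐ x ∂ν, 0 ≤ F n x) (hg : Integrable g ν)
    (hs : ∀ᵐ x ∂ν, HasSum (fun n => F n x) (g x)) :
    HasSum (fun n => ∫ x, F n x ∂ν) (∫ x, g x ∂ν) := by
  refine hasSum_integral_of_dominated_convergence F hF (fun n => ?_) ?_ ?_ hs
  · filter_upwards [h0 n] with x hx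
    rw [Real.norm_of_nonneg hx]
  · filter_upwards [hs] with x hx using hx.summable
  · exact hg.congr (by filter_upwards [hs] with x hx using hx.tsum_eq.symm)

/-- Tonelli's theorem. Integrability of the sum is a conclusion here, which suits `R`: only the
integrals of its series terms are known in advance. -/
lemma integrable_and_hasSum_integral_of_nonneg {X : Type*} [MeasurableSpace X] {ν : Measure X}
    {F : ℕ → X → ℝ} {g : X → ℝ} {v : ℝ} (hF : ∀ n, Integrable (F n) ν)
    (h0 : ∀ n, ∀ᵐ x ∂ν, 0 ≤ F n x) (hv : HasSum (fun n => ∫ x, F n x ∂ν) v)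
    (hs : ∀ᵐ x ∂ν, HasSum (fun n => F n x) (g x)) :
    Integrable g ν ∧ ∫ x, g x ∂ν = v := by
  have hn : ∀ n, ∫ x, ‖F n x‖ ∂ν = ∫ x, F n x ∂ν := fun n => integral_congr_ae (by
    filter_upwards [h0 n] with x hx
    rw [Real.norm_of_nonneg hx])
  have hsum := hasSum_integral_of_summable_integral_norm hF
    (by simpa only [hn] using hv.summable)
  have hgt : (fun x => ∑' n, F n x) =ᵐ[ν] g := by
    filter_upwards [hs] with x hx using hx.tsum_eq
  have hval : ∫ x, g x ∂ν = v := by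
    rw [← integral_congr_ae hgt]
    exact hsum.unique hv
  refine ⟨⟨?_, ?_⟩, hval⟩
  · exact aestronglyMeasurable_of_tendsto_ae Filter.atTop
      (fun n => (integrable_finsetSum (Finset.range n) (fun i _ => hF i)).aestronglyMeasurable)
      (by filter_upwards [hs] with x hx using hx.tendsto_sum_nat)
  · have h0' := ae_all_iff.2 h0
    have h1 : ∀ᵐ x ∂ν, ‖g x‖ₑ = ∑' n, ENNReal.ofReal (F n x) := by
      filter_upwards [hs, h0'] with x hx h0x
      rw [← hx.tsum_eq, Real.enorm_of_nonneg (tsum_nonneg h0x),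
        ENNReal.ofReal_tsum_of_nonneg h0x hx.summable]
    rw [HasFiniteIntegral, lintegral_congr_ae h1,
      lintegral_tsum fun n => (hF n).aestronglyMeasurable.aemeasurable.ennreal_ofReal]
    simp_rw [← fun n => ofReal_integral_eq_lintegral_ofReal (hF n) (h0 n)]
    rw [← ENNReal.ofReal_tsum_of_nonneg (fun n => integral_nonneg_of_ae (h0 n)) hv.summable]
    exact ENNReal.ofReal_lt_top

/-! ### Beta integrals and rising factorials -/

lemma integrableOn_betaIntegrand {p q : ℝ} (hp : 0 < p) (hq : 0 < q) :
    IntegrableOn (fun x : ℝ => x ^ (p - 1) * (1 - x) ^ (q - 1)) (Ioo 0 1) := by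
  have h := Complex.betaIntegral_convergent (u := p) (v := q) (by simpa) (by simpa)
  rw [intervalIntegrable_iff_integrableOn_Ioo_of_le zero_le_one] at h
  refine h.re.congr ((ae_restrict_mem measurableSet_Ioo).mono fun x hx => ?_)
  have h1 : ((x : ℂ) ^ ((p : ℂ) - 1)) = ((x ^ (p - 1) : ℝ) : ℂ) := by
    rw [Complex.ofReal_cpow hx.1.le]; push_cast; rfl
  have h2 : ((1 - x : ℂ) ^ ((q : ℂ) - 1)) = (((1 - x) ^ (q - 1) : ℝ) : ℂ) := by
    rw [Complex.ofReal_cpow (by linarith [hx.2])]; push_cast; rfl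
  change ((x : ℂ) ^ ((p : ℂ) - 1) * (1 - x : ℂ) ^ ((q : ℂ) - 1)).re = _
  rw [h1, h2, ← Complex.ofReal_mul, Complex.ofReal_re]

lemma integral_betaIntegrand {p q : ℝ} (hp : 0 < p) (hq : 0 < q) :
    ∫ x in Ioo (0 : ℝ) 1, x ^ (p - 1) * (1 - x) ^ (q - 1) =
      Real.Gamma p * Real.Gamma q / Real.Gamma (p + q) := by
  have h := ProbabilityTheory.beta_eq_betaIntegralReal p q hp hq
  rw [ProbabilityTheory.beta] at h
  rw [h, Complex.betaIntegral, intervalIntegral.integral_of_le zero_le_one,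
    integral_Ioc_eq_integral_Ioo, ← Complex.ofReal_re (∫ x in Ioo (0 : ℝ) 1, _),
    ← integral_complex_ofReal]
  congr 1
  refine setIntegral_congr_fun measurableSet_Ioo fun x hx => ?_
  rw [Complex.ofReal_mul, Complex.ofReal_cpow hx.1.le, Complex.ofReal_cpow (by linarith [hx.2])]
  push_cast
  rfl

/-- The rising factorial `a (a + 1) ⋯ (a + n - 1)`. -/
noncomputable def poch (a : ℝ) (n : ℕ) : ℝ := (ascPochhammer ℝ n).eval a

lemma poch_zero (a : ℝ) : poch a 0 = 1 := by simp [poch]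

lemma poch_succ (a : ℝ) (n : ℕ) : poch a (n + 1) = poch a n * (a + n) := by
  simp [poch, ascPochhammer_succ_eval]

lemma poch_nonneg {a : ℝ} (ha : 0 ≤ a) (n : ℕ) : 0 ≤ poch a n := by
  induction n with
  | zero => simp [poch_zero]
  | succ n ih => rw [poch_succ]; positivity

lemma Gamma_add_nat_eq_poch {a : ℝ} (ha : 0 < a) (n : ℕ) :
    Real.Gamma (a + n) = poch a n * Real.Gamma a := by
  induction n with
  | zero => simp [poch_zero]
  | succ n ih =>
    rw [poch_succ, Nat.cast_succ, ← add_assoc, Real.Gamma_add_one (by positivity), ih]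
    ring

lemma poch_zero_left (n : ℕ) : poch 0 n = if n = 0 then 1 else 0 := by
  simp [poch, ascPochhammer_eval_zero]

lemma hasSum_poch_div_factorial_mul_pow (a : ℝ) {t : ℝ} (ht : |t| < 1) :
    HasSum (fun n : ℕ => poch a n / n.factorial * t ^ n) ((1 - t) ^ (-a)) := by
  have h := (Real.one_div_one_sub_rpow_hasFPowerSeriesOnBall_zero a).hasSum (y := t)
    (by simpa [enorm_eq_nnnorm, ← NNReal.coe_lt_coe] using ht)
  have h1 : (1 - t) ^ (-a) = 1 / (1 - (0 + t)) ^ a := by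
    rw [Real.rpow_neg (by linarith [(abs_lt.1 ht).2]), zero_add, one_div]
  rw [h1]
  refine HasSum.congr_real h (fun n => ?_) rfl
  have h2 : Ring.choose (a + n - 1) n = poch a n / n.factorial := by
    rw [eq_div_iff (by positivity), mul_comm, ← nsmul_eq_mul,
      ← Ring.descPochhammer_eq_factorial_smul_choose,
      Polynomial.descPochhammer_smeval_eq_ascPochhammer, Polynomial.ascPochhammer_smeval_cast,
      Polynomial.ascPochhammer_smeval_eq_eval, poch]
    congr 1
    ring
  simp [h2, mul_comm]

/-! ### Gauss's summation theorem -/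

/-- Expand `(1 - x)^(-a)` inside the Beta integral of `x^(b-1) (1-x)^(c-a-b-1)` and integrate term
by term; for `a, b ≥ 0` all terms are nonnegative. -/
theorem hasSum_gauss {a b c : ℝ} (hb : 0 ≤ b) (ha : 0 ≤ a) (hc : a + b < c) :
    HasSum (fun n : ℕ => poch a n * poch b n / (n.factorial * Real.Gamma (c + n)))
      (Real.Gamma (c - a - b) / (Real.Gamma (c - a) * Real.Gamma (c - b))) := by
  -- For `b = 0` the Beta integral diverges, but the series reduces to its first term. This case is
  -- needed when `N = 2k`.
  rcases hb.eq_or_lt with rfl | hb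
  · refine HasSum.congr_real (hasSum_ite_eq (0 : ℕ) (1 / Real.Gamma c)) (fun n => ?_) ?_
    · rw [poch_zero_left]
      split_ifs with h <;> simp [h, poch_zero]
    · have := (Real.Gamma_pos_of_pos (show 0 < c - a by linarith)).ne'
      simp only [sub_zero]
      field_simp
  · have hcb : 0 < c - b := by linarith
    have hGb := (Real.Gamma_pos_of_pos hb).ne'
    have hGcb := (Real.Gamma_pos_of_pos hcb).ne'
    have key := hasSum_integral_of_integrable_of_nonneg (ν := volume.restrict (Ioo (0 : ℝ) 1))
      (F := fun n x => poch a n / n.factorial * (x ^ (b + n - 1) * (1 - x) ^ (c - b - 1)))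
      (g := fun x => x ^ (b - 1) * (1 - x) ^ (c - a - b - 1))
      (fun n => ((integrableOn_betaIntegrand (p := b + n) (by positivity)
        hcb).aestronglyMeasurable).const_mul _)
      (fun n => (ae_restrict_mem measurableSet_Ioo).mono fun x hx => by
        have := poch_nonneg ha n
        have h1 := Real.rpow_nonneg hx.1.le (b + n - 1)
        have h2 := Real.rpow_nonneg (sub_nonneg.2 hx.2.le) (c - b - 1)
        positivity)
      (integrableOn_betaIntegrand hb (by linarith))
      ((ae_restrict_mem measurableSet_Ioo).mono fun x hx => by
        have hx1 : 0 < 1 - x := by linarith [hx.2]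
        have := (hasSum_poch_div_factorial_mul_pow a
          (abs_lt.2 ⟨by linarith [hx.1], hx.2⟩)).mul_left (x ^ (b - 1) * (1 - x) ^ (c - b - 1))
        refine HasSum.congr_real this (fun n => ?_) ?_
        · rw [show b + n - 1 = (b - 1) + n by ring, Real.rpow_add hx.1, Real.rpow_natCast]
          ring
        · rw [mul_assoc, ← Real.rpow_add hx1]
          ring_nf)
    rw [integral_betaIntegrand hb (by linarith)] at key
    refine HasSum.congr_real (key.mul_right (1 / (Real.Gamma b * Real.Gamma (c - b))))
      (fun n => ?_) ?_
    · rw [integral_const_mul, integral_betaIntegrand (by positivity) hcb, Gamma_add_nat_eq_poch hb,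
        show b + n + (c - b) = c + n by ring]
      field_simp
    · rw [show b + (c - a - b) = c - a by ring]
      field_simp

/-! ### The Mellin transform of `R` -/

lemma hasSum_ordinaryHypergeometric {a b c x : ℝ} (ha : 0 < a) (hb : 0 ≤ b) (hc : 0 < c)
    (hx : |x| < 1) :
    HasSum (fun n : ℕ => poch a n * poch b n / (n.factorial * poch c n) * x ^ n)
      (ordinaryHypergeometric a b c x) := by
  have hr : 1 ≤ (ordinaryHypergeometricSeries ℝ a b c).radius := by
    rcases hb.eq_or_lt with rfl | hb
    · have := ordinaryHypergeometric_radius_top_of_neg_nat₂ (𝕂 := ℝ) ℝ a c (k := 0)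
      simp only [Nat.cast_zero, neg_zero] at this
      rw [this]
      exact le_top
    · rw [ordinaryHypergeometricSeries_radius_eq_one]
      intro k
      have : (0 : ℝ) ≤ k := k.cast_nonneg
      exact ⟨by linarith, by linarith, by linarith⟩
  have h := (ordinaryHypergeometricSeries ℝ a b c).hasSum (x := x)
    (Metric.eball_subset_eball hr (by simpa [enorm_eq_nnnorm, ← NNReal.coe_lt_coe] using hx))
  refine HasSum.congr_real h (fun n => ?_) rfl
  rw [ordinaryHypergeometricSeries_apply_eq, smul_eq_mul, poch, poch, poch]
  field_simp

/-- Integrating the series in powers of `1 - y` by Beta integrals replaces the lower parameter `c`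
by `m + 1 + c`, and Gauss's theorem applies. Since `c - a - b = k - 1`, the numerator is `Γ(m + k) =
(m + k - 1)!`. -/
theorem integral_pow_mul_R {N k : ℕ} (hk : 1 ≤ k) (hN : 2 * k ≤ N) (m : ℕ) :
    IntegrableOn (fun y => y ^ m * R N k y) (Ioo 0 1) ∧
    ∫ y in Ioo (0 : ℝ) 1, y ^ m * R N k y =
      (m.factorial * (m + k - 1).factorial / (k - 1).factorial : ℝ) *
        (Real.Gamma (N / 2) * Real.Gamma ((N + 1) / 2)) /
        (Real.Gamma (N / 2 + m) * Real.Gamma ((N + 1) / 2 + m)) := by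
  have hk' : (1 : ℝ) ≤ k := by exact_mod_cast hk
  have hN' : (2 * k : ℝ) ≤ N := by exact_mod_cast hN
  set a : ℝ := ((N : ℝ) + 1) / 2 - k with ha
  set b : ℝ := (N : ℝ) / 2 - k with hb
  set c : ℝ := (N : ℝ) - 1 / 2 - k with hc
  have ha0 : 0 < a := by linarith
  have hb0 : 0 ≤ b := by linarith
  have hc0 : 0 < c := by linarith
  have hGc := (Real.Gamma_pos_of_pos hc0).ne'
  set K : ℝ := Real.Gamma ((N : ℝ) / 2) * Real.Gamma (((N : ℝ) + 1) / 2) /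
    (Real.Gamma c * ((k - 1).factorial : ℝ)) with hK
  have hK0 : 0 ≤ K := by
    have h1 := (Real.Gamma_pos_of_pos (show 0 < (N : ℝ) / 2 by linarith)).le
    have h2 := (Real.Gamma_pos_of_pos (show 0 < ((N : ℝ) + 1) / 2 by linarith)).le
    have h3 := (Real.Gamma_pos_of_pos hc0).le
    positivity
  have hm0 : (0 : ℝ) < m + 1 := by positivity
  have hgauss := hasSum_gauss (a := a) (b := b) (c := m + 1 + c) hb0 ha0.le
    (by have : (0 : ℝ) ≤ m := m.cast_nonneg
        linarith)
  have hint : ∀ n : ℕ, IntegrableOn (fun y : ℝ => y ^ ((m + 1 : ℝ) - 1) *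
      (1 - y) ^ (c + n - 1)) (Ioo 0 1) := fun n =>
    integrableOn_betaIntegrand hm0 (by positivity)
  have hA : ∀ n : ℕ, 0 ≤ K * (poch a n * poch b n / (n.factorial * poch c n)) := fun n => by
    have h1 := poch_nonneg ha0.le n
    have h2 := poch_nonneg hb0 n
    have h3 := poch_nonneg hc0.le n
    positivity
  have hsum : HasSum (fun n : ℕ => ∫ y in Ioo (0 : ℝ) 1,
      K * (poch a n * poch b n / (n.factorial * poch c n)) *
        (y ^ ((m + 1 : ℝ) - 1) * (1 - y) ^ (c + n - 1)))
      (K * (Real.Gamma (m + 1) * Real.Gamma c) * (Real.Gamma (m + 1 + c - a - b) /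
        (Real.Gamma (m + 1 + c - a) * Real.Gamma (m + 1 + c - b)))) := by
    refine HasSum.congr_real (hgauss.mul_left (K * (Real.Gamma (m + 1) * Real.Gamma c)))
      (fun n => ?_) rfl
    rw [integral_const_mul, integral_betaIntegrand hm0 (by positivity), Gamma_add_nat_eq_poch hc0,
      ← add_assoc]
    have h3 : poch c n ≠ 0 := by
      intro h
      have h4 := Gamma_add_nat_eq_poch hc0 n
      rw [h, zero_mul] at h4
      exact (Real.Gamma_pos_of_pos (show 0 < c + n by positivity)).ne' h4
    field_simp
  have key := integrable_and_hasSum_integral_of_nonneg (ν := volume.restrict (Ioo (0 : ℝ) 1))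
    (g := fun y => y ^ m * R N k y) (fun n => (hint n).const_mul _)
    (fun n => (ae_restrict_mem measurableSet_Ioo).mono fun y hy => by
        have h1 := Real.rpow_nonneg hy.1.le ((m + 1 : ℝ) - 1)
        have h2 := Real.rpow_nonneg (sub_nonneg.2 hy.2.le) (c + n - 1)
        exact mul_nonneg (hA n) (mul_nonneg h1 h2)) hsum
    ((ae_restrict_mem measurableSet_Ioo).mono fun y hy => by
        have hy1 : 0 < 1 - y := by linarith [hy.2]
        have := (hasSum_ordinaryHypergeometric ha0 hb0 hc0 (x := 1 - y)
          (abs_lt.2 ⟨by linarith [hy.1], by linarith [hy.1]⟩)).mul_left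
          (y ^ m * (K * (1 - y) ^ (c - 1)))
        refine HasSum.congr_real this (fun n => ?_) ?_
        · rw [show c + n - 1 = (c - 1) + n by ring, Real.rpow_add hy1, Real.rpow_natCast,
            add_sub_cancel_right, Real.rpow_natCast]
          ring
        · rw [R, if_pos hy.2, show (N : ℝ) - 3 / 2 - k = c - 1 by rw [hc]; ring]
          ring)
  refine ⟨key.1, key.2.trans ?_⟩
  have hmk : (m : ℝ) + 1 + c - a - b = ((m + k - 1 : ℕ) : ℝ) + 1 := by
    rw [Nat.cast_sub (by omega), ha, hb, hc]
    push_cast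
    ring
  rw [hmk, Real.Gamma_nat_eq_factorial, Real.Gamma_nat_eq_factorial,
    show (m : ℝ) + 1 + c - a = N / 2 + m by rw [ha, hc]; ring,
    show (m : ℝ) + 1 + c - b = (N + 1) / 2 + m by rw [hb, hc]; ring, hK]
  field_simp

end NumericalShadow

namespace NumericalShadow

open MeasureTheory

/-! ### Gaussian moments on `ℂ^N` -/

lemma integral_norm_pow_mul_exp_neg_sq (a : ℕ) :
    ∫ z : ℂ, (‖z‖ ^ 2) ^ a * Real.exp (-‖z‖ ^ 2) = Real.pi * a.factorial := by
  have h := Complex.integral_rpow_mul_exp_neg_rpow (p := 2) (q := 2 * a) (by norm_num)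
    (by have : (0 : ℝ) ≤ a := a.cast_nonneg
        linarith)
  rw [show ((2 * a + 2) / 2 : ℝ) = a + 1 by ring, Real.Gamma_nat_eq_factorial] at h
  convert h using 1
  · refine integral_congr_ae (Filter.Eventually.of_forall fun z => ?_)
    simp only
    rw [Real.rpow_mul (norm_nonneg z), Real.rpow_natCast, Real.rpow_two]
  · ring

lemma integrable_norm_pow_mul_exp_neg_sq (a : ℕ) :
    Integrable fun z : ℂ => (‖z‖ ^ 2) ^ a * Real.exp (-‖z‖ ^ 2) := by
  -- A non-integrable function has the default integral `0`, so a nonzero value forces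
  -- integrability.
  refine not_imp_comm.1 integral_undef ?_
  rw [integral_norm_pow_mul_exp_neg_sq]
  positivity

lemma coeff_genSeries {ι : Type*} [Fintype ι] [DecidableEq ι] (lam : ι → ℝ) (m : ℕ) :
    PowerSeries.coeff m (genSeries lam) =
      ∑ a ∈ Finset.piAntidiag Finset.univ m, ∏ j, lam j ^ a j := by
  rw [genSeries, PowerSeries.coeff_prod]
  refine Finset.sum_bij' (fun l _ => ⇑l) (fun a _ => Finsupp.equivFunOnFinite.symm a) ?_ ?_ ?_ ?_ ?_
  · intro l hl
    simp only [Finset.mem_finsuppAntidiag] at hl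
    simp [hl.1]
  · intro a ha
    simp only [Finset.mem_piAntidiag] at ha
    simp [ha.1]
  · intro l _
    ext
    simp
  · intro a _
    ext
    simp
  · intro l _
    simp

/-- The Gaussian moments `π a_i!` cancel the denominators of the multinomial coefficients, so every
monomial of degree `m` gets the same weight. -/
theorem integral_pi_exp_neg_mul_pow {ι : Type*} [Fintype ι] (lam : ι → ℝ) (m : ℕ) :
    ∫ y : ι → ℂ, Real.exp (-∑ i, ‖y i‖ ^ 2) * (∑ i, lam i * ‖y i‖ ^ 2) ^ m =
      Real.pi ^ Fintype.card ι * m.factorial * PowerSeries.coeff m (genSeries lam) := by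
  classical
  have h1 : ∀ y : ι → ℂ, Real.exp (-∑ i, ‖y i‖ ^ 2) * (∑ i, lam i * ‖y i‖ ^ 2) ^ m =
      ∑ a ∈ Finset.piAntidiag Finset.univ m, (Nat.multinomial Finset.univ a * ∏ i, lam i ^ a i) *
        ∏ i, (‖y i‖ ^ 2) ^ a i * Real.exp (-‖y i‖ ^ 2) := fun y => by
    rw [Finset.sum_pow_eq_sum_piAntidiag, Finset.mul_sum]
    refine Finset.sum_congr rfl fun a _ => ?_
    rw [← Finset.sum_neg_distrib, Real.exp_sum]
    simp only [mul_pow, Finset.prod_mul_distrib]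
    ring
  simp_rw [h1]
  rw [integral_finsetSum _ fun a _ => (Integrable.fintype_prod (f := fun i (z : ℂ) =>
    (‖z‖ ^ 2) ^ a i * Real.exp (-‖z‖ ^ 2)) fun i =>
      integrable_norm_pow_mul_exp_neg_sq (a i)).const_mul _, coeff_genSeries, Finset.mul_sum]
  refine Finset.sum_congr rfl fun a ha => ?_
  rw [integral_const_mul, integral_fintype_prod_volume_eq_prod (fun i (z : ℂ) =>
    (‖z‖ ^ 2) ^ a i * Real.exp (-‖z‖ ^ 2))]
  simp only [integral_norm_pow_mul_exp_neg_sq, Finset.prod_mul_distrib, Finset.prod_const,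
    Finset.card_univ]
  have h2 := Nat.multinomial_spec Finset.univ a
  rw [(Finset.mem_piAntidiag.1 ha).1] at h2
  rw [← h2]
  push_cast
  ring

/-! ### Polar coordinates -/

/-- This trades the sphere integral for a Gaussian integral, which factors over coordinates. The
Gamma factor is the radial integral of `r^(d-1+2m) exp(-r²)`. -/
theorem integral_exp_neg_sq_mul_of_homogeneous {E : Type*} [NormedAddCommGroup E] [NormedSpace ℝ E]
    [FiniteDimensional ℝ E] [MeasurableSpace E] [BorelSpace E] [Nontrivial E] (ν : Measure E)
    [ν.IsAddHaarMeasure] {q : E → ℝ} {m : ℕ} (hq : ∀ (r : ℝ) (x : E), q (r • x) = r ^ (2 * m) * q x) :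
    ∫ x, Real.exp (-‖x‖ ^ 2) * q x ∂ν = (∫ u : Metric.sphere (0 : E) 1, q u ∂ν.toSphere) *
      (Real.Gamma (Module.finrank ℝ E / 2 + m) / 2) := by
  have hd : 0 < Module.finrank ℝ E := Module.finrank_pos
  calc
    _ = ∫ x : ({(0)}ᶜ : Set E), Real.exp (-‖x.1‖ ^ 2) * q x.1 ∂(ν.comap (↑)) := by
      rw [integral_subtype_comap (measurableSet_singleton _).compl
        fun x => Real.exp (-‖x‖ ^ 2) * q x, restrict_compl_singleton]
    _ = ∫ p : Metric.sphere (0 : E) 1 × Set.Ioi (0 : ℝ),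
          q p.1 * ((p.2 : ℝ) ^ (2 * m) * Real.exp (-(p.2 : ℝ) ^ 2))
          ∂ν.toSphere.prod (.volumeIoiPow (Module.finrank ℝ E - 1)) := by
      rw [← ν.measurePreserving_homeomorphUnitSphereProd.integral_comp
        (Homeomorph.measurableEmbedding _)]
      refine integral_congr_ae (Filter.Eventually.of_forall fun x => ?_)
      simp only [homeomorphUnitSphereProd_apply_snd_coe, homeomorphUnitSphereProd_apply_fst_coe]
      have hx : ‖(x : E)‖ ≠ 0 := norm_ne_zero_iff.2 x.2
      rw [hq, inv_pow]
      field_simp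
    _ = (∫ u : Metric.sphere (0 : E) 1, q u ∂ν.toSphere) *
        ∫ r : Set.Ioi (0 : ℝ), (r : ℝ) ^ (2 * m) * Real.exp (-(r : ℝ) ^ 2)
          ∂(.volumeIoiPow (Module.finrank ℝ E - 1)) :=
      integral_prod_mul (fun u : Metric.sphere (0 : E) 1 => q u)
        (fun r : Set.Ioi (0 : ℝ) => (r : ℝ) ^ (2 * m) * Real.exp (-(r : ℝ) ^ 2))
    _ = _ := by
      congr 1
      simp only [Measure.volumeIoiPow, ENNReal.ofReal]
      rw [integral_withDensity_eq_integral_smul (by fun_prop),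
        integral_subtype_comap measurableSet_Ioi fun r : ℝ =>
          Real.toNNReal (r ^ (Module.finrank ℝ E - 1)) • (r ^ (2 * m) * Real.exp (-r ^ 2))]
      have h := integral_rpow_mul_exp_neg_rpow (p := 2)
        (q := (Module.finrank ℝ E - 1 + 2 * m : ℕ)) (by norm_num)
        (lt_of_lt_of_le (by norm_num) (Nat.cast_nonneg _))
      have h2 : (((Module.finrank ℝ E - 1 + 2 * m : ℕ) : ℝ) + 1) / 2 =
          Module.finrank ℝ E / 2 + m := by
        rw [← Nat.cast_succ, show (Module.finrank ℝ E - 1 + 2 * m).succ =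
          Module.finrank ℝ E + 2 * m by omega]
        push_cast
        ring
      rw [h2] at h
      rw [show Real.Gamma (Module.finrank ℝ E / 2 + m) / 2 =
        1 / 2 * Real.Gamma (Module.finrank ℝ E / 2 + m) by ring, ← h]
      refine setIntegral_congr_fun measurableSet_Ioi fun r hr => ?_
      rw [NNReal.smul_def, Real.coe_toNNReal _ (pow_nonneg (le_of_lt hr) _), smul_eq_mul,
        Real.rpow_natCast, Real.rpow_two, pow_add]
      ring

/-! ### Moments of the numerical shadow of a Hermitian matrix -/

instance {N : ℕ} [NeZero N] : Nontrivial (Vec N) :=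
  inferInstanceAs (Nontrivial (EuclideanSpace ℂ (Fin N)))

lemma finrank_real_vec (N : ℕ) : Module.finrank ℝ (Vec N) = 2 * N := by
  rw [finrank_real_of_complex, finrank_euclideanSpace_fin]

/-- Coordinates with respect to a unitary basis change volume by a constant factor. -/
lemma exists_integral_eq_const_mul_integral_repr {N : ℕ} (b : OrthonormalBasis (Fin N) ℂ (Vec N)) :
    ∃ c : ℝ, ∀ F : Vec N → ℝ,
      ∫ x, F x = c * ∫ y : Fin N → ℂ, F (b.repr.symm (WithLp.toLp 2 y)) := by
  let L : (Fin N → ℂ) ≃L[ℂ] Vec N :=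
    (PiLp.continuousLinearEquiv 2 ℂ (fun _ : Fin N => ℂ)).symm.trans
      b.repr.symm.toContinuousLinearEquiv
  -- Uniqueness of Haar measure gives the constant; its value is never needed.
  have hH : ((volume : Measure (Fin N → ℂ)).map L).IsAddHaarMeasure :=
    AddEquiv.isAddHaarMeasure_map _ (L : (Fin N → ℂ) ≃+ Vec N) L.continuous L.symm.continuous
  refine ⟨Measure.addHaarScalarFactor volume ((volume : Measure (Fin N → ℂ)).map L), fun F => ?_⟩
  conv_lhs => rw [Measure.isAddLeftInvariant_eq_smul (volume : Measure (Vec N))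
    ((volume : Measure (Fin N → ℂ)).map L)]
  rw [integral_smul_nnreal_measure,
    MeasurableEmbedding.integral_map (f := ⇑L) L.toHomeomorph.measurableEmbedding]
  rfl

lemma inner_toEuclideanLin_eq_sum {N : ℕ} {H : Matrix (Fin N) (Fin N) ℂ} (hH : H.IsHermitian)
    (x : Vec N) :
    inner ℂ x (Matrix.toEuclideanLin H x) =
      ((∑ i, hH.eigenvalues i * ‖hH.eigenvectorBasis.repr x i‖ ^ 2 : ℝ) : ℂ) := by
  have hs := Matrix.isSymmetric_toEuclideanLin_iff.mpr hH
  have he : ∀ i, Matrix.toEuclideanLin H (hH.eigenvectorBasis i) =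
      (hH.eigenvalues i : ℂ) • hH.eigenvectorBasis i := fun i => by
    have := hH.mulVec_eigenvectorBasis i
    ext j
    simpa using congrFun this j
  rw [← hH.eigenvectorBasis.sum_inner_mul_inner x (Matrix.toEuclideanLin H x), Complex.ofReal_sum]
  refine Finset.sum_congr rfl fun i _ => ?_
  rw [← hs, he, inner_smul_left, OrthonormalBasis.repr_apply_apply,
    ← inner_conj_symm x (hH.eigenvectorBasis i), Complex.conj_ofReal]
  push_cast
  rw [← Complex.conj_mul']
  ring

instance isProbabilityMeasure_uniformSphere {N : ℕ} [NeZero N] :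
    IsProbabilityMeasure (uniformSphere N) := by
  constructor
  rw [uniformSphere, Measure.smul_apply, smul_eq_mul]
  exact ENNReal.inv_mul_cancel
    (Measure.measure_univ_ne_zero.2 (Measure.toSphere_ne_zero _)) (measure_ne_top _ _)

theorem integral_sphere_inner_pow {N : ℕ} [NeZero N] {H : Matrix (Fin N) (Fin N) ℂ}
    (hH : H.IsHermitian) (m : ℕ) :
    ∫ u : Metric.sphere (0 : Vec N) 1,
        (inner ℂ (u : Vec N) (Matrix.toEuclideanLin H (u : Vec N))).re ^ m ∂uniformSphere N =
      m.factorial * Real.Gamma N / Real.Gamma (N + m) *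
        PowerSeries.coeff m (genSeries hH.eigenvalues) := by
  obtain ⟨c, hc⟩ := exists_integral_eq_const_mul_integral_repr hH.eigenvectorBasis
  set q : Vec N → ℝ := fun x => (inner ℂ x (Matrix.toEuclideanLin H x)).re with hq
  have hsum : ∀ x, q x = ∑ i, hH.eigenvalues i * ‖hH.eigenvectorBasis.repr x i‖ ^ 2 := fun x => by
    simp only [hq]
    rw [inner_toEuclideanLin_eq_sum hH, Complex.ofReal_re]
  have hJ : ∀ m : ℕ, (∫ u : Metric.sphere (0 : Vec N) 1, q u ^ m ∂(volume : Measure (Vec N)).toSphere) *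
      (Real.Gamma (N + m) / 2) =
      c * (Real.pi ^ N * m.factorial * PowerSeries.coeff m (genSeries hH.eigenvalues)) := fun m => by
    have h1 := integral_exp_neg_sq_mul_of_homogeneous (volume : Measure (Vec N))
      (q := fun x => q x ^ m) (m := m) fun r x => by
        rw [hsum, hsum, pow_mul, ← mul_pow, Finset.mul_sum]
        congr 1
        refine Finset.sum_congr rfl fun i _ => ?_
        rw [RCLike.real_smul_eq_coe_smul (K := ℂ), map_smul, PiLp.smul_apply, norm_smul, mul_pow]
        simp
        ring
    rw [finrank_real_vec, Nat.cast_mul, Nat.cast_two, mul_div_cancel_left₀ _ two_ne_zero] at h1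
    rw [← h1, hc]
    congr 1
    have h2 := integral_pi_exp_neg_mul_pow hH.eigenvalues m
    rw [Fintype.card_fin] at h2
    rw [← h2]
    refine integral_congr_ae (Filter.Eventually.of_forall fun y => ?_)
    simp only [hsum, LinearIsometryEquiv.apply_symm_apply, LinearIsometryEquiv.norm_map,
      EuclideanSpace.norm_sq_eq]
  have hG : ∀ m : ℕ, 0 < Real.Gamma ((N : ℝ) + m) := fun m => Real.Gamma_pos_of_pos (by
    have : (0 : ℝ) < N := by exact_mod_cast NeZero.pos N
    positivity)
  -- The case `m = 0` relates `c` to the total mass of the sphere, so both drop out of the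
  -- normalized moment.
  have h0 := hJ 0
  have hc0 : PowerSeries.coeff 0 (genSeries hH.eigenvalues) = 1 := by
    simp [genSeries, map_prod]
  simp only [pow_zero, integral_const, smul_eq_mul, mul_one, Nat.cast_zero, add_zero, hc0,
    Nat.factorial_zero, Nat.cast_one] at h0
  have hσ : (volume : Measure (Vec N)).toSphere.real Set.univ ≠ 0 := by
    rw [Measure.real, ENNReal.toReal_ne_zero]
    exact ⟨Measure.measure_univ_ne_zero.2 (Measure.toSphere_ne_zero _), measure_ne_top _ _⟩
  have hm := hJ m
  have hGm := (hG m).ne'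
  rw [uniformSphere, integral_smul_measure, ENNReal.toReal_inv, smul_eq_mul]
  change ((volume : Measure (Vec N)).toSphere.real Set.univ)⁻¹ * ∫ u : Metric.sphere (0 : Vec N) 1,
    q u ^ m ∂(volume : Measure (Vec N)).toSphere = _
  field_simp
  linear_combination 2 * hm - 2 * m.factorial *
    PowerSeries.coeff m (genSeries hH.eigenvalues) * h0

end NumericalShadow

namespace NumericalShadow

open MeasureTheory Set

/-! ### Rotation-invariant measures on `ℂ` -/

/-- A measure on the plane is radial if it is invariant under all rotations about the origin. -/
def IsRadial (κ : Measure ℂ) : Prop :=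
  ∀ θ : ℝ, κ.map (fun z => Complex.exp (θ * Complex.I) * z) = κ

lemma IsRadial.add {κ₁ κ₂ : Measure ℂ} (h₁ : IsRadial κ₁) (h₂ : IsRadial κ₂) :
    IsRadial (κ₁ + κ₂) := fun θ => by
  rw [Measure.map_add _ _ (by fun_prop), h₁, h₂]

lemma measurableEmbedding_rot (θ : ℝ) :
    MeasurableEmbedding fun z : ℂ => Complex.exp (θ * Complex.I) * z :=
  (Homeomorph.mulLeft₀ _ (Complex.exp_ne_zero (θ * Complex.I))).measurableEmbedding

lemma measurePreserving_rot (θ : ℝ) :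
    MeasurePreserving (fun z : ℂ => Complex.exp (θ * Complex.I) * z) := by
  convert (rotation (Circle.exp θ)).measurePreserving using 1
  ext z
  simp [Circle.coe_exp]

lemma isRadial_withDensity_norm (g : ℝ → ENNReal) :
    IsRadial (volume.withDensity fun z : ℂ => g ‖z‖) := fun θ => by
  ext s hs
  rw [(measurableEmbedding_rot θ).map_apply,
    withDensity_apply _ ((measurableEmbedding_rot θ).measurable hs), withDensity_apply _ hs,
    ← (measurePreserving_rot θ).setLIntegral_comp_preimage_emb (measurableEmbedding_rot θ)
      (fun z => g ‖z‖) s]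
  simp [Complex.norm_exp_ofReal_mul_I]

lemma IsRadial.integral_re_pow_odd {κ : Measure ℂ} (h : IsRadial κ) (l : ℕ) :
    ∫ z, z.re ^ (2 * l + 1) ∂κ = 0 := by
  have h1 : ∫ z, z.re ^ (2 * l + 1) ∂κ = ∫ z, -z.re ^ (2 * l + 1) ∂κ := by
    -- The half turn sends `z` to `-z`.
    conv_lhs => rw [← h Real.pi, (measurableEmbedding_rot _).integral_map]
    refine integral_congr_ae (Filter.Eventually.of_forall fun z => ?_)
    simp only [Complex.exp_pi_mul_I, neg_one_mul, Complex.neg_re]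
    rw [Odd.neg_pow ⟨l, rfl⟩]
  rw [integral_neg] at h1
  linarith

lemma integrable_re_pow {κ : Measure ℂ} [IsFiniteMeasure κ] {B : ℝ} (hB : ∀ᵐ z ∂κ, ‖z‖ ≤ B)
    (m : ℕ) : Integrable (fun z : ℂ => z.re ^ m) κ := by
  refine Integrable.of_bound (by fun_prop) (B ^ m) (hB.mono fun z hz => ?_)
  rw [norm_pow]
  exact pow_le_pow_left₀ (norm_nonneg _) ((Complex.abs_re_le_norm z).trans hz) m

/-- Rotating by `arg t` turns the pairing with `t` into `‖t‖ Re z`; bounded support then allows the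
exponential series to be integrated termwise. -/
lemma IsRadial.charFun_eq {κ : Measure ℂ} [IsFiniteMeasure κ] (h : IsRadial κ) {B : ℝ}
    (hB : ∀ᵐ z ∂κ, ‖z‖ ≤ B) (t : ℂ) :
    charFun κ t = ∑' m : ℕ, (‖t‖ * Complex.I) ^ m / m.factorial * ((∫ z, z.re ^ m ∂κ : ℝ) : ℂ) := by
  have h1 : charFun κ t = ∫ z, Complex.exp (‖t‖ * Complex.I * z.re) ∂κ := by
    conv_lhs => rw [charFun_apply, ← h t.arg, (measurableEmbedding_rot _).integral_map]
    refine integral_congr_ae (Filter.Eventually.of_forall fun z => ?_)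
    simp only
    congr 1
    have : inner ℝ (Complex.exp (t.arg * Complex.I) * z) t = ‖t‖ * z.re := by
      have ht := Complex.norm_mul_exp_arg_mul_I t
      generalize t.arg = φ at ht ⊢
      rw [Complex.inner, map_mul, ← Complex.exp_conj, map_mul, Complex.conj_I, Complex.conj_ofReal,
        show t * (Complex.exp (φ * -Complex.I) * (starRingEnd ℂ) z) =
          (Complex.exp (φ * Complex.I) * Complex.exp (φ * -Complex.I)) *
          (‖t‖ * (starRingEnd ℂ) z) by
            conv_lhs => rw [← ht]
            ring, ← Complex.exp_add]
      simp
    rw [this]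
    push_cast
    ring
  rw [h1]
  have hF : ∀ m : ℕ, Integrable
      (fun z : ℂ => (‖t‖ * Complex.I) ^ m / m.factorial * ((z.re ^ m : ℝ) : ℂ)) κ := fun m =>
    ((integrable_re_pow hB m).ofReal).const_mul _
  have key := hasSum_integral_of_summable_integral_norm (μ := κ) hF ?_
  · rw [← integral_congr_ae (f := fun z : ℂ => ∑' m : ℕ,
        (‖t‖ * Complex.I) ^ m / m.factorial * ((z.re ^ m : ℝ) : ℂ)), ← key.tsum_eq]
    · refine tsum_congr fun m => ?_
      rw [integral_const_mul, integral_complex_ofReal]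
    · refine Filter.Eventually.of_forall fun z => ?_
      simp only
      rw [Complex.exp_eq_exp_ℂ, NormedSpace.exp_eq_tsum_div]
      refine tsum_congr fun m => ?_
      push_cast
      rw [mul_pow _ (z.re : ℂ)]
      ring
  · refine Summable.of_nonneg_of_le (fun m => integral_nonneg fun z => norm_nonneg _)
      (fun m => ?_) ((Real.summable_pow_div_factorial (‖t‖ * B)).mul_right (κ.real univ))
    have hb : ∀ᵐ z ∂κ, ‖(‖t‖ * Complex.I) ^ m / m.factorial * ((z.re ^ m : ℝ) : ℂ)‖ ≤
        (‖t‖ * B) ^ m / m.factorial := hB.mono fun z hz => by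
      rw [norm_mul, norm_div, norm_pow, norm_mul, Complex.norm_I, mul_one, Complex.norm_real,
        Complex.norm_real, norm_norm, norm_pow, Complex.norm_natCast, mul_pow, mul_div_right_comm]
      gcongr
      exact (Complex.abs_re_le_norm z).trans hz
    calc _ ≤ ∫ _, (‖t‖ * B) ^ m / m.factorial ∂κ :=
          integral_mono_ae (hF m).norm (integrable_const _) hb
      _ = _ := by rw [integral_const, smul_eq_mul, mul_comm]

theorem IsRadial.ext_of_moments {κ₁ κ₂ : Measure ℂ} [IsFiniteMeasure κ₁] [IsFiniteMeasure κ₂]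
    (h₁ : IsRadial κ₁) (h₂ : IsRadial κ₂) {B : ℝ} (hB₁ : ∀ᵐ z ∂κ₁, ‖z‖ ≤ B)
    (hB₂ : ∀ᵐ z ∂κ₂, ‖z‖ ≤ B)
    (hm : ∀ l : ℕ, ∫ z, z.re ^ (2 * l) ∂κ₁ = ∫ z, z.re ^ (2 * l) ∂κ₂) : κ₁ = κ₂ := by
  refine Measure.ext_of_charFun (funext fun t => ?_)
  rw [h₁.charFun_eq hB₁, h₂.charFun_eq hB₂]
  refine tsum_congr fun m => ?_
  congr 2
  obtain ⟨l, rfl | rfl⟩ := Nat.even_or_odd' m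
  · exact hm l
  · rw [h₁.integral_re_pow_odd, h₂.integral_re_pow_odd]

/-- Moment uniqueness concerns positive measures, so the negative part of `f` is moved to the other
side: `P + νm = νp`. As `νp` vanishes where `f < 0`, so does `νm`, and therefore `νm = 0`. -/
theorem isPlanarDensity_of_moments {P : Measure ℂ} [IsFiniteMeasure P] (hP : IsRadial P) {B : ℝ}
    (hB : ∀ᵐ z ∂P, ‖z‖ ≤ B) {f : ℝ → ℝ} (hf : Integrable fun z : ℂ => f ‖z‖)
    (hfB : ∀ r, B < r → f r = 0)
    (hm : ∀ l : ℕ, ∫ z, z.re ^ (2 * l) ∂P = ∫ z : ℂ, z.re ^ (2 * l) * f ‖z‖) :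
    IsPlanarDensity P fun z => f ‖z‖ := by
  have hden : ∀ g : ℝ → ℝ, Integrable (fun z : ℂ => g ‖z‖) → (∀ r, B < r → g r = 0) →
      IsFiniteMeasure (volume.withDensity fun z : ℂ => ENNReal.ofReal (g ‖z‖)) ∧
      (∀ᵐ z ∂(volume.withDensity fun z : ℂ => ENNReal.ofReal (g ‖z‖)), ‖z‖ ≤ B) ∧
      ∀ m : ℕ, ∫ z, z.re ^ m ∂(volume.withDensity fun z : ℂ => ENNReal.ofReal (g ‖z‖)) =
        ∫ z : ℂ, (ENNReal.ofReal (g ‖z‖)).toReal * z.re ^ m := fun g hg hgB => by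
    have hmeas := hg.aestronglyMeasurable.aemeasurable.ennreal_ofReal
    refine ⟨isFiniteMeasure_withDensity_ofReal hg.2, ?_, fun m => ?_⟩
    · rw [ae_withDensity_iff' hmeas]
      refine Filter.Eventually.of_forall fun z hz => ?_
      by_contra hlt
      exact hz (by rw [hgB _ (not_le.1 hlt), ENNReal.ofReal_zero])
    · rw [integral_withDensity_eq_integral_toReal_smul₀ hmeas
        (Filter.Eventually.of_forall fun z => ENNReal.ofReal_lt_top)]
      rfl
  obtain ⟨i₁, b₁, m₁⟩ := hden f hf hfB
  obtain ⟨i₂, b₂, m₂⟩ := hden (fun r => -f r) hf.neg fun r hr => by rw [hfB r hr, neg_zero]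
  set νp := volume.withDensity fun z : ℂ => ENNReal.ofReal (f ‖z‖) with hνp
  set νm := volume.withDensity fun z : ℂ => ENNReal.ofReal (-f ‖z‖) with hνm
  have rp : IsRadial νp := isRadial_withDensity_norm fun r => ENNReal.ofReal (f r)
  have rm : IsRadial νm := isRadial_withDensity_norm fun r => ENNReal.ofReal (-f r)
  have hint : ∀ g : ℝ → ℝ, Integrable (fun z : ℂ => g ‖z‖) → (∀ r, B < r → g r = 0) → ∀ m : ℕ,
      Integrable fun z : ℂ => (ENNReal.ofReal (g ‖z‖)).toReal * z.re ^ m := fun g hg hgB m => by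
    refine Integrable.mono' (hg.norm.mul_const (B ^ m)) ?_
      (Filter.Eventually.of_forall fun z => ?_)
    · exact (hg.aestronglyMeasurable.aemeasurable.ennreal_ofReal.ennreal_toReal.mul
        (by fun_prop)).aestronglyMeasurable
    · by_cases hz : ‖z‖ ≤ B
      · rw [norm_mul, norm_pow]
        refine mul_le_mul ?_ ?_ (by positivity) (norm_nonneg _)
        · rw [ENNReal.toReal_ofReal', Real.norm_of_nonneg (le_max_right _ _)]
          exact max_le (le_abs_self _) (abs_nonneg _)
        · exact pow_le_pow_left₀ (norm_nonneg _) ((Complex.abs_re_le_norm z).trans hz) m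
      · simp [hgB _ (not_le.1 hz)]
  have heq : P + νm = νp := by
    refine (hP.add rm).ext_of_moments rp (B := B) ?_ b₁ fun l => ?_
    · rw [ae_add_measure_iff]
      exact ⟨hB, b₂⟩
    · rw [integral_add_measure (integrable_re_pow hB _) (integrable_re_pow b₂ _), hm, m₁, m₂,
        ← eq_sub_iff_add_eq, ← integral_sub (hint f hf hfB _)
          (hint (fun r => -f r) hf.neg (fun r hr => by rw [hfB r hr, neg_zero]) _)]
      refine integral_congr_ae (Filter.Eventually.of_forall fun z => ?_)
      simp only [ENNReal.toReal_ofReal']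
      rw [← sub_mul, mul_comm]
      congr 1
      rcases le_total 0 (f ‖z‖) with h | h
      · rw [max_eq_left h, max_eq_right (by linarith), sub_zero]
      · rw [max_eq_right h, max_eq_left (by linarith), zero_sub, neg_neg]
  have hnn : ∀ᵐ z : ℂ, 0 ≤ f ‖z‖ := by
    obtain ⟨f', hf', hff'⟩ := hf.aestronglyMeasurable.aemeasurable
    -- The measurable representative `f'` makes the negativity set measurable.
    have hs : MeasurableSet {z : ℂ | f' z < 0} := measurableSet_lt hf' measurable_const
    have h0 : νp {z | f' z < 0} = 0 := by
      rw [hνp, withDensity_apply _ hs, lintegral_eq_zero_iff' (by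
        exact hf.aestronglyMeasurable.aemeasurable.ennreal_ofReal.restrict)]
      rw [Filter.EventuallyEq, ae_restrict_iff' hs]
      filter_upwards [hff'] with z hz hz0
      have : f' z < 0 := hz0
      simp only [Pi.zero_apply, ENNReal.ofReal_eq_zero]
      linarith
    have h1 : νm {z | f' z < 0} = 0 := by
      rw [← heq, Measure.add_apply] at h0
      exact (add_eq_zero.1 h0).2
    rw [hνm, withDensity_apply _ hs, lintegral_eq_zero_iff' (by
        exact hf.neg.aestronglyMeasurable.aemeasurable.ennreal_ofReal.restrict),
      Filter.EventuallyEq, ae_restrict_iff' hs] at h1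
    filter_upwards [hff', h1] with z hz hz1
    by_contra hlt
    have h2 := hz1 (show f' z < 0 by linarith)
    simp only [Pi.zero_apply, ENNReal.ofReal_eq_zero] at h2
    linarith
  refine ⟨hf, hnn, ?_⟩
  have hm0 : νm = 0 := by
    rw [hνm, withDensity_eq_zero_iff (by
      exact hf.neg.aestronglyMeasurable.aemeasurable.ennreal_ofReal)]
    filter_upwards [hnn] with z hz
    simp only [Pi.zero_apply, ENNReal.ofReal_eq_zero]
    linarith
  rw [← hνp, ← heq, hm0, add_zero]

/-! ### Moments of radial densities -/

lemma integral_cos_pow_even (l : ℕ) :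
    ∫ x in -Real.pi..Real.pi, Real.cos x ^ (2 * l) = 2 * Real.pi * l.centralBinom / 4 ^ l := by
  induction l with
  | zero => simp; ring
  | succ l ih =>
    rw [mul_add_one, integral_cos_pow, ih]
    have h := Nat.succ_mul_centralBinom_succ l
    have h' : ((l : ℝ) + 1) * (l + 1).centralBinom = 2 * (2 * l + 1) * l.centralBinom := by
      exact_mod_cast h
    have h2 : ((l + 1).centralBinom : ℝ) = 2 * (2 * l + 1) * l.centralBinom / (l + 1) := by
      rw [← h']
      field_simp
    rw [h2]
    simp
    field_simp
    ring

lemma integrable_comp_norm_sq_div {h : ℝ → ℝ} (hh : ∀ y, 1 ≤ y → h y = 0)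
    (hi : IntegrableOn h (Ioo 0 1)) {a : ℝ} (ha : 0 < a) :
    Integrable fun z : ℂ => h (‖z‖ ^ 2 / a ^ 2) := by
  have h1 : IntegrableOn h (Ioi 0) :=
    hi.of_forall_sdiff_eq_zero measurableSet_Ioi fun y hy =>
      hh y (not_lt.1 fun hlt => hy.2 ⟨hy.1, hlt⟩)
  have h2 := (integrableOn_Ioi_comp_mul_right_iff h 0 (a := (a ^ 2)⁻¹) (by positivity)).2
    (by rwa [zero_mul])
  have h3 := (integrableOn_Ioi_comp_rpow_iff _ (two_ne_zero (α := ℝ))).2 h2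
  rw [integrable_fun_norm_addHaar volume (f := fun r => h (r ^ 2 / a ^ 2)), Complex.finrank_real_complex]
  refine IntegrableOn.congr_fun (f := fun r => 2⁻¹ * _) (h3.const_mul 2⁻¹) (fun r _ => ?_)
    measurableSet_Ioi
  simp only [abs_two, smul_eq_mul, Real.rpow_two, div_eq_mul_inv]
  norm_num
  ring

lemma integrable_re_pow_mul_comp_norm_sq_div {h : ℝ → ℝ} (hh : ∀ y, 1 ≤ y → h y = 0)
    (hi : IntegrableOn h (Ioo 0 1)) {a : ℝ} (ha : 0 < a) (m : ℕ) :
    Integrable fun z : ℂ => z.re ^ m * h (‖z‖ ^ 2 / a ^ 2) := by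
  have h1 := integrable_comp_norm_sq_div hh hi ha
  refine Integrable.mono' (h1.norm.const_mul (a ^ m))
    ((by fun_prop : AEStronglyMeasurable fun z : ℂ => z.re ^ m).mul h1.aestronglyMeasurable)
    (Filter.Eventually.of_forall fun z => ?_)
  rw [norm_mul, norm_pow]
  by_cases hz : ‖z‖ ≤ a
  · gcongr
    exact (Complex.abs_re_le_norm z).trans hz
  · rw [hh _ ((one_le_div (by positivity)).2 (pow_le_pow_left₀ ha.le (not_le.1 hz).le 2))]
    simp

/-- In polar coordinates the angular factor is the integral of `cos^(2l)`, and `y = r²/a²` turns the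
radial factor into a Mellin moment of `h`. -/
theorem integral_re_pow_mul_comp_norm_sq_div {h : ℝ → ℝ} (hh : ∀ y, 1 ≤ y → h y = 0)
    {a : ℝ} (ha : 0 < a) (l : ℕ) :
    ∫ z : ℂ, z.re ^ (2 * l) * h (‖z‖ ^ 2 / a ^ 2) =
      Real.pi * l.centralBinom / 4 ^ l * a ^ (2 * l + 2) * ∫ y in Ioo (0 : ℝ) 1, y ^ l * h y := by
  have h1 : ∫ y in Ioo (0 : ℝ) 1, y ^ l * h y = ∫ y in Ioi (0 : ℝ), y ^ l * h y :=
    (setIntegral_eq_of_subset_of_forall_sdiff_eq_zero measurableSet_Ioi Ioo_subset_Ioi_self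
      fun y hy => by rw [hh y (not_lt.1 fun hlt => hy.2 ⟨hy.1, hlt⟩), mul_zero]).symm
  have h2 : ∫ y in Ioi (0 : ℝ), y ^ l * h (y * (a ^ 2)⁻¹) =
      a ^ (2 * l + 2) * ∫ y in Ioi (0 : ℝ), y ^ l * h y := by
    have := integral_comp_mul_right_Ioi (fun y => y ^ l * h y) 0 (b := (a ^ 2)⁻¹) (by positivity)
    rw [zero_mul, inv_inv, smul_eq_mul] at this
    simp only [mul_pow, mul_assoc] at this
    rw [pow_add, pow_mul, mul_assoc, ← this, ← integral_const_mul]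
    refine setIntegral_congr_fun measurableSet_Ioi fun y _ => ?_
    have h0 : (a ^ 2) ^ l * (a ^ 2)⁻¹ ^ l = 1 := by
      rw [← mul_pow, mul_inv_cancel₀ (by positivity), one_pow]
    linear_combination -(y ^ l * h (y * (a ^ 2)⁻¹)) * h0
  have h3 : ∫ r in Ioi (0 : ℝ), r ^ (2 * l + 1) * h (r ^ 2 / a ^ 2) =
      1 / 2 * (a ^ (2 * l + 2) * ∫ y in Ioi (0 : ℝ), y ^ l * h y) := by
    rw [← h2, ← integral_comp_rpow_Ioi (fun y => y ^ l * h (y * (a ^ 2)⁻¹)) (two_ne_zero (α := ℝ)),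
      ← integral_const_mul]
    refine setIntegral_congr_fun measurableSet_Ioi fun r _ => ?_
    simp only [abs_two, smul_eq_mul, Real.rpow_two, div_eq_mul_inv]
    norm_num
    ring
  rw [← Complex.integral_comp_polarCoord_symm, polarCoord_target]
  have h4 : ∀ p ∈ Ioi (0 : ℝ) ×ˢ Ioo (-Real.pi) Real.pi,
      p.1 • ((Complex.polarCoord.symm p).re ^ (2 * l) *
        h (‖Complex.polarCoord.symm p‖ ^ 2 / a ^ 2)) =
      (p.1 ^ (2 * l + 1) * h (p.1 ^ 2 / a ^ 2)) * Real.cos p.2 ^ (2 * l) := fun p hp => by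
    rw [Complex.norm_polarCoord_symm, sq_abs, Complex.polarCoord_symm_apply]
    simp only [Complex.mul_re, Complex.add_re, Complex.ofReal_re, Complex.I_re, Complex.I_im,
      Complex.ofReal_im, smul_eq_mul, mul_zero, zero_mul, sub_zero, add_zero, mul_one, mul_pow]
    ring
  rw [setIntegral_congr_fun (measurableSet_Ioi.prod measurableSet_Ioo) h4, Measure.volume_eq_prod,
    setIntegral_prod_mul (fun r : ℝ => r ^ (2 * l + 1) * h (r ^ 2 / a ^ 2))
      (fun x : ℝ => Real.cos x ^ (2 * l)), h3, ← integral_Ioc_eq_integral_Ioo,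
    ← intervalIntegral.integral_of_le (by linarith [Real.pi_pos]), integral_cos_pow_even, h1]
  ring

end NumericalShadow

namespace NumericalShadow

open MeasureTheory Polynomial

/-! ### Spectra symmetric about the origin -/

lemma prod_one_sub_eq_of_genSeries_eq {ι : Type*} [Fintype ι] {lam lam' : ι → ℝ}
    (h : genSeries lam = genSeries lam') :
    (∏ j, (1 - C (lam j) * X) : ℝ[X]) = ∏ j, (1 - C (lam' j) * X) := by
  refine Polynomial.coe_injective ℝ ?_
  have h1 := genSeries_mul_prod lam
  have h2 := genSeries_mul_prod lam'
  rw [h, mul_comm] at h1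
  exact left_inv_eq_right_inv h1 h2

lemma genSeries_neg {ι : Type*} [Fintype ι] (lam : ι → ℝ) :
    genSeries (fun j => -lam j) = PowerSeries.rescale (-1) (genSeries lam) := by
  rw [genSeries, genSeries, map_prod]
  refine Finset.prod_congr rfl fun j _ => ?_
  rw [PowerSeries.rescale_mk]
  congr 1
  ext m
  rw [neg_pow]

lemma genSeries_neg_eq {ι : Type*} [Fintype ι] {lam : ι → ℝ}
    (h : ∀ l, PowerSeries.coeff (2 * l + 1) (genSeries lam) = 0) :
    genSeries (fun j => -lam j) = genSeries lam := by
  ext m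
  rw [genSeries_neg, PowerSeries.coeff_rescale]
  obtain ⟨l, rfl | rfl⟩ := Nat.even_or_odd' m
  · simp [pow_mul]
  · rw [h, mul_zero]

/-- Reversing the polynomials, via `x^N p(1/x)`, gives `∏ (X - λ_j)`, whose root multisets can be
compared. -/
lemma card_filter_eq_neg {N : ℕ} {lam : Fin N → ℝ}
    (h : (∏ j, (1 - C (lam j) * X) : ℝ[X]) = ∏ j, (1 - C (-lam j) * X)) (x : ℝ) :
    (Finset.univ.filter fun j => lam j = x).card =
      (Finset.univ.filter fun j => lam j = -x).card := by
  have h1 : (∏ j, (X - C (lam j)) : ℝ[X]) = ∏ j, (X - C (-lam j)) := by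
    refine eq_of_infinite_eval_eq _ _ ((Set.Ioi_infinite (0 : ℝ)).mono fun x hx => ?_)
    have hx : x ≠ 0 := ne_of_gt hx
    have h2 := congrArg (fun p => x ^ N * eval x⁻¹ p) h
    have h3 : ∀ a : Fin N → ℝ, x ^ N * eval x⁻¹ (∏ j, (1 - C (a j) * X)) =
        eval x (∏ j, (X - C (a j))) := fun a => by
      have hpow : x ^ N = ∏ _j : Fin N, x := by simp
      rw [eval_prod, eval_prod, hpow, ← Finset.prod_mul_distrib]
      refine Finset.prod_congr rfl fun j _ => ?_
      simp
      field_simp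
    simp only [h3] at h2
    exact h2
  have h4 := congrArg roots h1
  rw [Finset.prod_eq_multiset_prod, Finset.prod_eq_multiset_prod] at h4
  rw [show Multiset.map (fun j => X - C (lam j)) Finset.univ.val =
      Multiset.map (fun a => X - C a) (Multiset.map lam Finset.univ.val) by
      rw [Multiset.map_map]; rfl,
    show Multiset.map (fun j => X - C (-lam j)) Finset.univ.val =
      Multiset.map (fun a => X - C a) (Multiset.map (fun j => -lam j) Finset.univ.val) by
      rw [Multiset.map_map]; rfl,
    roots_multiset_prod_X_sub_C, roots_multiset_prod_X_sub_C] at h4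
  have h5 := congrArg (Multiset.count x) h4
  rw [Multiset.count_map, Multiset.count_map] at h5
  have h6 : (Finset.univ.filter fun j => x = lam j).card =
      (Finset.univ.filter fun j => x = -lam j).card := h5
  rw [Finset.filter_congr fun j _ => eq_comm, h6]
  congr 1
  refine Finset.filter_congr fun j _ => ?_
  rw [eq_comm, neg_eq_iff_eq_neg]

/-- Group the factors by eigenvalue: zero contributes `1`, and each pair `±μ_i` contributes `(1 -
μ_i² X²)^(k_i)`. -/
lemma prod_one_sub_eq_prod_sq {N n : ℕ} {lam : Fin N → ℝ} {μ : Fin n → ℝ} {k : Fin n → ℕ}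
    (hsym : ∀ x, (Finset.univ.filter fun j => lam j = x).card =
      (Finset.univ.filter fun j => lam j = -x).card)
    (hinj : Function.Injective μ) (hpos : ∀ i, 0 < μ i)
    (hμ : ∀ j, 0 < lam j → ∃ i, μ i = lam j)
    (hk : ∀ i, k i = (Finset.univ.filter fun j => lam j = μ i).card) :
    (∏ j, (1 - C (lam j) * X) : ℝ[X]) = ∏ i, (1 - C (μ i ^ 2) * X ^ 2) ^ k i := by
  classical
  have hmaps : ∀ j ∈ (Finset.univ : Finset (Fin N)), lam j ∈
      insert 0 (Finset.univ.image μ ∪ Finset.univ.image fun i => -μ i) := fun j _ => by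
    simp only [Finset.mem_insert, Finset.mem_union, Finset.mem_image, Finset.mem_univ, true_and]
    rcases lt_trichotomy (lam j) 0 with hj | hj | hj
    · have : 0 < (Finset.univ.filter fun l => lam l = -lam j).card := by
        rw [← hsym]
        exact Finset.card_pos.2 ⟨j, by simp⟩
      obtain ⟨l, hl⟩ := Finset.card_pos.1 this
      have hl : lam l = -lam j := by simpa using hl
      obtain ⟨i, hi⟩ := hμ l (by linarith)
      exact Or.inr (Or.inr ⟨i, by linarith⟩)
    · exact Or.inl hj
    · exact Or.inr (Or.inl (hμ j hj))
  have hfib : ∀ x : ℝ, (∏ j ∈ Finset.univ.filter (fun j => lam j = x), (1 - C (lam j) * X) : ℝ[X]) =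
      (1 - C x * X) ^ (Finset.univ.filter fun j => lam j = x).card := fun x => by
    rw [← Finset.prod_const]
    exact Finset.prod_congr rfl fun j hj => by rw [(Finset.mem_filter.1 hj).2]
  rw [← Finset.prod_fiberwise_of_maps_to hmaps]
  simp only [hfib]
  rw [Finset.prod_insert, Finset.prod_union, Finset.prod_image (hinj.injOn),
    Finset.prod_image fun a _ b _ hab => hinj (neg_injective hab), ← Finset.prod_mul_distrib]
  · simp only [map_zero, zero_mul, sub_zero, one_pow, one_mul]
    refine Finset.prod_congr rfl fun i _ => ?_
    rw [← hsym, ← hk, ← mul_pow]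
    congr 1
    simp only [map_neg, map_pow]
    ring
  · rw [Finset.disjoint_left]
    intro x hx hx'
    obtain ⟨i, -, rfl⟩ := Finset.mem_image.1 hx
    obtain ⟨l, -, hl⟩ := Finset.mem_image.1 hx'
    have := hpos i
    have := hpos l
    linarith
  · simp only [Finset.mem_union, Finset.mem_image, Finset.mem_univ, true_and, not_or, not_exists]
    exact ⟨fun i => (hpos i).ne', fun i => (neg_lt_zero.2 (hpos i)).ne⟩

/-! ### The numerical shadow -/

lemma isHermitian_rePart {N : ℕ} (A : Matrix (Fin N) (Fin N) ℂ) : (rePart A).IsHermitian := by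
  rw [rePart, Matrix.IsHermitian, Matrix.conjTranspose_smul, Matrix.conjTranspose_add,
    Matrix.conjTranspose_conjTranspose, add_comm]
  simp

lemma re_inner_toEuclideanLin {N : ℕ} (A : Matrix (Fin N) (Fin N) ℂ) (u : Vec N) :
    (inner ℂ u (Matrix.toEuclideanLin A u)).re =
      (inner ℂ u (Matrix.toEuclideanLin (rePart A) u)).re := by
  have h : (inner ℂ u (Matrix.toEuclideanLin A.conjTranspose u)).re =
      (inner ℂ u (Matrix.toEuclideanLin A u)).re := by
    rw [Matrix.toEuclideanLin_conjTranspose_eq_adjoint, LinearMap.adjoint_inner_right,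
      ← inner_conj_symm, Complex.conj_re]
  rw [rePart, map_smul, map_add, LinearMap.smul_apply, LinearMap.add_apply, inner_smul_right,
    inner_add_right, Complex.mul_re, Complex.add_re, h]
  norm_num
  ring

lemma continuous_inner_toEuclideanLin {N : ℕ} (A : Matrix (Fin N) (Fin N) ℂ) :
    Continuous fun u : Metric.sphere (0 : Vec N) 1 =>
      inner ℂ (u : Vec N) (Matrix.toEuclideanLin A (u : Vec N)) :=
  continuous_subtype_val.inner
    ((LinearMap.continuous_of_finiteDimensional _).comp continuous_subtype_val)

instance isProbabilityMeasure_shadow {N : ℕ} [NeZero N] (A : Matrix (Fin N) (Fin N) ℂ) :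
    IsProbabilityMeasure (shadow A) :=
  Measure.isProbabilityMeasure_map (continuous_inner_toEuclideanLin A).measurable.aemeasurable

lemma exists_ae_norm_le_shadow {N : ℕ} (A : Matrix (Fin N) (Fin N) ℂ) :
    ∃ B : ℝ, ∀ᵐ z ∂shadow A, ‖z‖ ≤ B := by
  obtain ⟨B, hB⟩ := (isCompact_range (continuous_inner_toEuclideanLin A)).isBounded.exists_norm_le
  refine ⟨B, ?_⟩
  rw [shadow, ae_map_iff (continuous_inner_toEuclideanLin A).measurable.aemeasurable
    (measurableSet_le (by fun_prop) (by fun_prop))]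
  exact Filter.Eventually.of_forall fun u => hB _ (Set.mem_range_self u)

lemma HasRotationInvariantShadow.isRadial {N : ℕ} {A : Matrix (Fin N) (Fin N) ℂ}
    (h : HasRotationInvariantShadow A) : IsRadial (shadow A) := fun θ => by
  conv_rhs => rw [← h θ]
  rw [shadow, Measure.map_map (by fun_prop) (continuous_inner_toEuclideanLin A).measurable, shadow]
  congr 1
  ext u
  simp

theorem integral_re_pow_shadow {N : ℕ} [NeZero N] (A : Matrix (Fin N) (Fin N) ℂ) (m : ℕ) :
    ∫ z, z.re ^ m ∂shadow A = m.factorial * Real.Gamma N / Real.Gamma (N + m) *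
      PowerSeries.coeff m (genSeries (isHermitian_rePart A).eigenvalues) := by
  rw [← integral_sphere_inner_pow, shadow,
    integral_map (continuous_inner_toEuclideanLin A).measurable.aemeasurable (by fun_prop)]
  simp only [re_inner_toEuclideanLin A]

lemma genSeries_eq_of_shadow_eq {N : ℕ} [NeZero N] {A A' : Matrix (Fin N) (Fin N) ℂ}
    (h : shadow A = shadow A') : genSeries (isHermitian_rePart A).eigenvalues =
      genSeries (isHermitian_rePart A').eigenvalues := by
  ext m
  have hN : (0 : ℝ) < N := by exact_mod_cast NeZero.pos N
  have h1 := integral_re_pow_shadow A m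
  rw [h, integral_re_pow_shadow] at h1
  have hG := (Real.Gamma_pos_of_pos hN).ne'
  have hG' := (Real.Gamma_pos_of_pos (show (0 : ℝ) < N + m by positivity)).ne'
  exact (mul_left_cancel₀ (by positivity) h1).symm

lemma coeff_odd_genSeries {N : ℕ} [NeZero N] {A : Matrix (Fin N) (Fin N) ℂ}
    (h : HasRotationInvariantShadow A) (l : ℕ) :
    PowerSeries.coeff (2 * l + 1) (genSeries (isHermitian_rePart A).eigenvalues) = 0 := by
  have hN : (0 : ℝ) < N := by exact_mod_cast NeZero.pos N
  have h1 := integral_re_pow_shadow A (2 * l + 1)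
  rw [h.isRadial.integral_re_pow_odd] at h1
  have hG := (Real.Gamma_pos_of_pos hN).ne'
  have hG' := (Real.Gamma_pos_of_pos
    (show (0 : ℝ) < N + (2 * l + 1 : ℕ) by positivity)).ne'
  exact (mul_eq_zero.1 h1.symm).resolve_left (by positivity)

lemma eq_zero_of_genSeries_eq_one {ι : Type*} [Fintype ι] {lam : ι → ℝ} (h : genSeries lam = 1)
    (j : ι) : lam j = 0 := by
  have h1 := genSeries_mul_prod lam
  rw [h, one_mul, Polynomial.coe_eq_one_iff] at h1
  by_contra hj
  have h2 := congrArg (eval (lam j)⁻¹) h1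
  rw [eval_prod, eval_one, Finset.prod_eq_zero (Finset.mem_univ j) (by simp [hj])] at h2
  exact zero_ne_one h2

/-- A nonzero matrix with rotation-invariant shadow has a Hermitian part with a positive
eigenvalue. -/
lemma exists_pos_eigenvalue {N : ℕ} [NeZero N] {A : Matrix (Fin N) (Fin N) ℂ} (hA : A ≠ 0)
    (h : HasRotationInvariantShadow A) : ∃ j, 0 < (isHermitian_rePart A).eigenvalues j := by
  by_contra! hneg
  have hsym := card_filter_eq_neg (prod_one_sub_eq_of_genSeries_eq
    (genSeries_neg_eq (coeff_odd_genSeries h))).symm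
  have h0 : ∀ j, (isHermitian_rePart A).eigenvalues j = 0 := fun j => by
    by_contra hj
    have h1 : 0 < (Finset.univ.filter fun l => (isHermitian_rePart A).eigenvalues l =
        -(isHermitian_rePart A).eigenvalues j).card := by
      rw [← hsym]
      exact Finset.card_pos.2 ⟨j, by simp⟩
    obtain ⟨l, hl⟩ := Finset.card_pos.1 h1
    have hl : (isHermitian_rePart A).eigenvalues l = -(isHermitian_rePart A).eigenvalues j := by
      simpa using hl
    have h2 := lt_of_le_of_ne (hneg j) hj
    have h3 := hneg l
    linarith
  have hone : genSeries (isHermitian_rePart A).eigenvalues = 1 := by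
    rw [genSeries]
    refine Finset.prod_eq_one fun j _ => ?_
    ext m
    rw [h0, PowerSeries.coeff_mk, PowerSeries.coeff_one, zero_pow_eq]
  have hre : rePart A = 0 := (isHermitian_rePart A).eigenvalues_eq_zero_iff.1 (funext h0)
  -- `iA` has the same shadow, hence the same eigenvalue generating series for its Hermitian part.
  -- Vanishing of the Hermitian parts of `A` and `iA` forces `A = 0`.
  have him : rePart (Complex.exp ((Real.pi / 2 : ℝ) * Complex.I) • A) = 0 := by
    refine (isHermitian_rePart _).eigenvalues_eq_zero_iff.1 (funext fun j => ?_)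
    exact eq_zero_of_genSeries_eq_one ((genSeries_eq_of_shadow_eq (h (Real.pi / 2))).trans hone) j
  refine hA ?_
  have he : Complex.exp ((Real.pi / 2 : ℝ) * Complex.I) = Complex.I := by
    push_cast
    exact Complex.exp_pi_div_two_mul_I
  rw [he] at him
  ext i j
  have h1 := congrFun (congrFun hre i) j
  have h2 := congrFun (congrFun him i) j
  simp [rePart] at h1 h2
  have hI := Complex.I_ne_zero
  have h3 : A i j - (starRingEnd ℂ) (A j i) = 0 :=
    mul_left_cancel₀ hI (by linear_combination h2)
  simp only [Matrix.zero_apply]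
  linear_combination (h1 + h3) / 2

/-! ### The density -/

/-- The quotient of Legendre's duplication formulas at `x/2` and `x/2 + l`. -/
lemma Gamma_div_Gamma_add_two_mul {x : ℝ} (hx : 0 < x) (l : ℕ) :
    Real.Gamma x / Real.Gamma (x + (2 * l : ℕ)) =
      Real.Gamma (x / 2) * Real.Gamma ((x + 1) / 2) /
        (4 ^ l * (Real.Gamma (x / 2 + l) * Real.Gamma ((x + 1) / 2 + l))) := by
  have h1 := Real.Gamma_mul_Gamma_add_half (x / 2)
  have h2 := Real.Gamma_mul_Gamma_add_half (x / 2 + l)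
  rw [show x / 2 + 1 / 2 = (x + 1) / 2 by ring, mul_div_cancel₀ x two_ne_zero] at h1
  rw [show x / 2 + l + 1 / 2 = (x + 1) / 2 + l by ring,
    show 2 * (x / 2 + l) = x + (2 * l : ℕ) by push_cast; ring,
    show 1 - (x + (2 * l : ℕ)) = (1 - x) - (2 * l : ℕ) by ring, Real.rpow_sub two_pos,
    Real.rpow_natCast, pow_mul] at h2
  rw [h1, h2]
  have hG := (Real.Gamma_pos_of_pos (show 0 < x + (2 * l : ℕ) by positivity)).ne'
  have h3 := (Real.rpow_pos_of_pos two_pos (1 - x)).ne'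
  have h4 := (Real.sqrt_pos.2 Real.pi_pos).ne'
  norm_num
  field_simp

lemma R_eq_zero {N k : ℕ} {y : ℝ} (hy : 1 ≤ y) : R N k y = 0 := if_neg (not_lt.2 hy)

/-- The `4^l` of the duplication formula cancels that of the angular integral. What remains is the
prefactor of the shadow moments times the coefficient of `s^(2l)` in `(1 - a² s²)^(-k)`. -/
lemma integral_re_pow_mul_R {N k : ℕ} (hk : 1 ≤ k) (hN : 2 * k ≤ N) {a : ℝ} (ha : 0 < a) (l : ℕ) :
    ∫ z : ℂ, z.re ^ (2 * l) * R N k (‖z‖ ^ 2 / a ^ 2) = Real.pi * a ^ 2 *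
      ((2 * l).factorial * Real.Gamma N / Real.Gamma (N + (2 * l : ℕ)) *
        (a ^ (2 * l) * ((k - 1 + l).choose (k - 1) : ℝ))) := by
  have hN0 : (0 : ℝ) < N := by exact_mod_cast (by omega : 0 < N)
  rw [integral_re_pow_mul_comp_norm_sq_div (fun y hy => R_eq_zero hy) ha,
    (integral_pow_mul_R hk hN l).2, mul_div_assoc ((2 * l).factorial : ℝ),
    Gamma_div_Gamma_add_two_mul hN0, Nat.cast_add_choose, Nat.centralBinom, two_mul l,
    Nat.cast_add_choose, show l + k - 1 = k - 1 + l by omega]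
  have h1 := (Real.Gamma_pos_of_pos (show (0 : ℝ) < N / 2 + l by positivity)).ne'
  have h2 := (Real.Gamma_pos_of_pos (show (0 : ℝ) < (N + 1) / 2 + l by positivity)).ne'
  field_simp
  ring

theorem existsUnique_and_isPlanarDensity_shadow {N : ℕ} (A : Matrix (Fin N) (Fin N) ℂ) (hA : A ≠ 0)
    (hrot : HasRotationInvariantShadow A)
    {n : ℕ} (μ : Fin n → ℝ) (k : Fin n → ℕ)
    (hinj : Function.Injective μ)
    (hμ : ∀ x : ℝ, (∃ i, μ i = x) ↔
      0 < x ∧ Module.End.HasEigenvalue (Matrix.toLin' (rePart A)) (x : ℂ))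
    (hk : ∀ i, k i = (rePart A).charpoly.rootMultiplicity (μ i : ℂ)) :
    (∃! α : (i : Fin n) → Fin (k i) → ℝ, IsPartialFractionCoeffs μ k α) ∧
    ∀ α : (i : Fin n) → Fin (k i) → ℝ, IsPartialFractionCoeffs μ k α →
      IsPlanarDensity (shadow A) (fun z : ℂ =>
        1 / Real.pi * ∑ i, ∑ j : Fin (k i),
          α i j * (1 / μ i ^ 2) * R N (k i - (j : ℕ)) (‖z‖ ^ 2 / μ i ^ 2)) := by
  have hN : NeZero N := ⟨by
    rintro rfl
    exact hA (Subsingleton.elim _ _)⟩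
  set hH := isHermitian_rePart A
  set lam := hH.eigenvalues with hlam
  have hpos : ∀ i, 0 < μ i := fun i => ((hμ (μ i)).1 ⟨i, rfl⟩).1
  have heig : ∀ x : ℝ, Module.End.HasEigenvalue (Matrix.toLin' (rePart A)) (x : ℂ) ↔
      ∃ j, lam j = x := fun x => by
    rw [Module.End.hasEigenvalue_iff_isRoot_charpoly, Matrix.charpoly_toLin', hH.charpoly_eq,
      IsRoot, eval_prod, Finset.prod_eq_zero_iff]
    simp [sub_eq_zero, hlam]
    exact exists_congr fun j => eq_comm
  have hkc : ∀ i, k i = (Finset.univ.filter fun j => lam j = μ i).card := fun i => by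
    rw [hk, ← count_roots, hH.roots_charpoly_eq_eigenvalues, Multiset.count_map]
    change (Finset.univ.filter _).card = _
    congr 1
    refine Finset.filter_congr fun j _ => ?_
    simp [eq_comm, hlam]
  have hsym := card_filter_eq_neg (prod_one_sub_eq_of_genSeries_eq
    (genSeries_neg_eq (coeff_odd_genSeries hrot))).symm
  have hprod := prod_one_sub_eq_prod_sq hsym hinj hpos
    (fun j hj => (hμ _).2 ⟨hj, (heig _).2 ⟨j, rfl⟩⟩) hkc
  have hkpos : ∀ i, 0 < k i := fun i => by
    obtain ⟨j, hj⟩ := (heig _).1 ((hμ (μ i)).1 ⟨i, rfl⟩).2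
    rw [hkc]
    exact Finset.card_pos.2 ⟨j, by simp [hj]⟩
  -- The eigenvalues `μ_i` and `-μ_i` occupy disjoint index sets of size `k i`; this gives the range
  -- of `k` in which the moments of `R` are known.
  have hkN : ∀ i, 2 * k i ≤ N := fun i => by
    rw [two_mul]
    nth_rewrite 2 [hkc]
    rw [hsym, hkc, ← Finset.card_union_of_disjoint]
    · exact (Finset.card_le_univ _).trans_eq (Fintype.card_fin N)
    · refine Finset.disjoint_filter.2 fun j _ h1 h2 => ?_
      have := hpos i
      linarith
  refine ⟨existsUnique_isPartialFractionCoeffs hinj hpos ?_, fun α hα => ?_⟩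
  · obtain ⟨j, hj⟩ := exists_pos_eigenvalue hA hrot
    obtain ⟨i, -⟩ := (hμ _).2 ⟨hj, (heig _).2 ⟨j, rfl⟩⟩
    exact ⟨i, hkpos i⟩
  · obtain ⟨B, hB⟩ := exists_ae_norm_le_shadow A
    have hR : ∀ i (j : Fin (k i)), IntegrableOn (R N (k i - (j : ℕ))) (Set.Ioo 0 1) := fun i j => by
      have := (integral_pow_mul_R (N := N) (k := k i - (j : ℕ))
        (by have := j.2; omega) (by have := hkN i; omega) 0).1
      simpa using this
    refine isPlanarDensity_of_moments (f := fun r => 1 / Real.pi * ∑ i, ∑ j : Fin (k i),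
      α i j * (1 / μ i ^ 2) * R N (k i - (j : ℕ)) (r ^ 2 / μ i ^ 2)) hrot.isRadial
      -- The sum of the positive `μ i` bounds each of them, so every term of the density vanishes
      -- beyond it.
      (B := max B (∑ i, μ i)) (hB.mono fun z hz => hz.trans (le_max_left _ _)) ?_ ?_ ?_
    · refine Integrable.const_mul (integrable_finsetSum _ fun i _ =>
        integrable_finsetSum _ fun j _ => Integrable.const_mul ?_ _) _
      exact integrable_comp_norm_sq_div (fun y hy => R_eq_zero hy) (hR i j) (hpos i)
    · intro r hr
      rw [Finset.sum_eq_zero, mul_zero]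
      refine fun i _ => Finset.sum_eq_zero fun j _ => ?_
      have h1 : μ i < r := lt_of_le_of_lt
        (Finset.single_le_sum (fun i _ => (hpos i).le) (Finset.mem_univ i))
        ((le_max_right _ _).trans_lt hr)
      rw [R_eq_zero, mul_zero]
      have := hpos i
      rw [one_le_div (by positivity)]
      exact pow_le_pow_left₀ this.le h1.le 2
    · intro l
      rw [integral_re_pow_shadow, coeff_genSeries_of_isPartialFractionCoeffs hα hprod]
      have hi : ∀ i (j : Fin (k i)), Integrable fun z : ℂ => z.re ^ (2 * l) * (1 / Real.pi *
          (α i j * (1 / μ i ^ 2) * R N (k i - (j : ℕ)) (‖z‖ ^ 2 / μ i ^ 2))) := fun i j => by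
        refine ((integrable_re_pow_mul_comp_norm_sq_div (fun y hy => R_eq_zero hy) (hR i j)
          (hpos i) (2 * l)).const_mul (1 / Real.pi * (α i j * (1 / μ i ^ 2)))).congr
          (Filter.Eventually.of_forall fun z => ?_)
        simp only
        ring
      simp only [Finset.mul_sum]
      rw [integral_finsetSum]
      · refine Finset.sum_congr rfl fun i _ => ?_
        rw [integral_finsetSum]
        · refine Finset.sum_congr rfl fun j _ => ?_
          have h1 : ∀ z : ℂ, z.re ^ (2 * l) * (1 / Real.pi * (α i j * (1 / μ i ^ 2) *
              R N (k i - (j : ℕ)) (‖z‖ ^ 2 / μ i ^ 2))) = (1 / Real.pi * (α i j * (1 / μ i ^ 2))) *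
              (z.re ^ (2 * l) * R N (k i - (j : ℕ)) (‖z‖ ^ 2 / μ i ^ 2)) := fun z => by ring
          simp only [h1]
          rw [integral_const_mul, integral_re_pow_mul_R (by have := j.2; omega)
            (by have := hkN i; omega) (hpos i)]
          have h2 := (hpos i).ne'
          field_simp
        · exact fun j _ => hi i j
      · exact fun i _ => integrable_finsetSum _ fun j _ => hi i j

end NumericalShadow

theorem proposition8p9 {N : ℕ} (A : Matrix (Fin N) (Fin N) ℂ) (hA : A ≠ 0)
    (hrot : NumericalShadow.HasRotationInvariantShadow A)
    {n : ℕ} (μ : Fin n → ℝ) (k : Fin n → ℕ)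
    (hinj : Function.Injective μ)
    (hμ : ∀ x : ℝ, (∃ i, μ i = x) ↔
      0 < x ∧ Module.End.HasEigenvalue (Matrix.toLin' (NumericalShadow.rePart A)) (x : ℂ))
    (hk : ∀ i, k i = (NumericalShadow.rePart A).charpoly.rootMultiplicity (μ i : ℂ)) :
    (∃! α : (i : Fin n) → Fin (k i) → ℝ, NumericalShadow.IsPartialFractionCoeffs μ k α) ∧
    ∀ α : (i : Fin n) → Fin (k i) → ℝ, NumericalShadow.IsPartialFractionCoeffs μ k α →
      NumericalShadow.IsPlanarDensity (NumericalShadow.shadow A) (fun z : ℂ =>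
        1 / Real.pi * ∑ i, ∑ j : Fin (k i),
          α i j * (1 / μ i ^ 2) * NumericalShadow.R N (k i - (j : ℕ)) (‖z‖ ^ 2 / μ i ^ 2)) :=
  NumericalShadow.existsUnique_and_isPlanarDensity_shadow A hA hrot μ k hinj hμ hk
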